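/- Let $q$ be a prime power. For $u,v\in\mathbb F_{q^2}^n$ put $\langle u,v\rangle_{\rm H}=\sum_i u_iv_i^q$; for a linear code $\mathcal C\subseteq\mathbb F_{q^2}^n$ let $\mathcal C^{\perp_{\rm H}}$ be its dual with respect to this form and $\mathrm{Hull}_{\rm H}(\mathcal C)=\mathcal C\cap\mathcal C^{\perp_{\rm H}}$. For a set $X$ of vectors, $\mathrm{wt}(X)$ is the least Hamming weight of a nonzero vector of $X$. An $[[n,\kappa,r,\delta]]_q$ subsystem code is a subspace of $(\mathbb C^q)^{\otimes n}$ isometrically identified with $A\otimes B$, where $\dim A=q^\kappa$ and $\dim B=q^r$, that has minimum distance $\delta$: every operator acting on fewer than $\delta$ of the $n$ positions, compressed to $A\otimes B$, has the form $1_A\otimes X$, and for some operator acting on $\delta$ positions this fails. If $\mathcal C$ has dimension $k$ and Hermitian hull of dimension $\ell$, and $k+\ell<n$, then the subsystem code obtained from $\mathcal C$ has the parameters $[[n,\,n-k-\ell,\,k-\ell,\,\delta]]_q$ with $\delta=\mathrm{wt}(\mathrm{Hull}_{\rm H}(\mathcal C)^{\perp_{\rm H}}\setminus\mathcal C)$;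 it is pure if also $\delta=\mathrm{wt}(\mathrm{Hull}_{\rm H}(\mathcal C)^{\perp_{\rm H}})$. Parameters $[[n,\kappa,r,\delta]]_q$ are optimal if $\kappa+r=n-2\delta+2$. Theorem. Let the subsystem code obtained from a linear code $\mathcal C\subseteq\mathbb F_{q^2}^n$ have optimal parameters $[[n,\kappa,r,\delta]]_q$, and let $1\le s\le\delta-1$. 1. There is an optimal $[[n-s,\kappa,r+s,\delta-s]]_q$ subsystem code, and these are the parameters of the subsystem code obtained from some linear code in $\mathbb F_{q^2}^{n-s}$. 2. If moreover the code obtained from $\mathcal C$ is pure, then there is an optimal $[[n-s,\kappa+s,r,\delta-s]]_q$ subsystem code, and these are the parameters of the subsystem code obtained from some linear code in $\mathbb F_{q^2}^{n-s}$. -/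

import Mathlib

open scoped Matrix Kronecker

/-! ## Classical linear codes over a field with `q ^ 2` elements -/

section Classical

variable {F : Type*} [Field F] [Fintype F] {n : ℕ}

/-- The Hermitian inner product `∑ i, u i * (v i) ^ q` of two vectors over the field with `q ^ 2`
elements. -/
def hermInner (q : ℕ) (u v : Fin n → F) : F :=
  ∑ i, u i * v i ^ q

/-- The Hermitian dual `{u | ⟨u, v⟩ = 0 for all v ∈ C}` of a linear code. -/
def hermDual (q : ℕ) (C : Submodule F (Fin n → F)) : Submodule F (Fin n → F) where
  carrier := {u | ∀ v ∈ C, hermInner q u v = 0}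
  zero_mem' := by
    intro v _
    simp [hermInner]
  add_mem' := by
    intro a b ha hb v hv
    have h1 := ha v hv
    have h2 := hb v hv
    simp only [hermInner] at h1 h2 ⊢
    simp [add_mul, Finset.sum_add_distrib, h1, h2]
  smul_mem' := by
    intro c a ha v hv
    have h1 := ha v hv
    simp only [hermInner] at h1 ⊢
    simp [mul_assoc, ← Finset.mul_sum, h1]

/-- The Hermitian hull of a linear code: its intersection with its Hermitian dual. -/
def hermHull (q : ℕ) (C : Submodule F (Fin n → F)) : Submodule F (Fin n → F) :=
  C ⊓ hermDual q C

/-- `wt S = w`: the least Hamming weight of a nonzero vector of `S` exists and equals `w`. -/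
def IsMinWeight [DecidableEq F] (S : Set (Fin n → F)) (w : ℕ) : Prop :=
  IsLeast {m : ℕ | ∃ v ∈ S, v ≠ 0 ∧ hammingNorm v = m} w

/-- `[[n, κ, r, δ]]_q` are the parameters of the subsystem code obtained from the linear code
`C` of length `n` over the field with `q ^ 2` elements: with `k = dim C` and `ℓ = dim Hull C`,
the code `C` satisfies `k + ℓ < n`, and `κ = n - k - ℓ`, `r = k - ℓ`,
`δ = wt ((Hull C)^⊥ \ C)`. -/
structure IsSubsystemParams [DecidableEq F] (q : ℕ) (C : Submodule F (Fin n → F))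
    (κ r δ : ℕ) : Prop where
  lt : Module.finrank F C + Module.finrank F (hermHull q C) < n
  kappa : κ + Module.finrank F C + Module.finrank F (hermHull q C) = n
  gauge : r + Module.finrank F (hermHull q C) = Module.finrank F C
  dist : IsMinWeight ((hermDual q (hermHull q C) : Set (Fin n → F)) \ (C : Set (Fin n → F))) δ

/-- The subsystem code of minimum distance `δ` obtained from `C` is pure (nondegenerate):
`δ = d ((Hull C)^⊥)`. -/
def IsPureAt [DecidableEq F] (q : ℕ) (C : Submodule F (Fin n → F)) (δ : ℕ) : Prop :=
  IsMinWeight (hermDual q (hermHull q C) : Set (Fin n → F)) δ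

end Classical

/-! ## Quantum subsystem codes -/

/-- The operator `E` on `(ℂ^q)^{⊗ n}`, written in the standard basis indexed by
`Fin n → Fin q`, acts only on the positions in `T`: it is of the form `f ⊗ 1`, with `f` an operator
on the tensor factors in `T` and `1` the identity on the others. -/
def ActsOn {q n : ℕ} (T : Finset (Fin n)) (E : Matrix (Fin n → Fin q) (Fin n → Fin q) ℂ) : Prop :=
  ∃ f : Matrix (T → Fin q) (T → Fin q) ℂ, ∀ x y : Fin n → Fin q,
    ((∀ i, i ∉ T → x i = y i) → E x y = f (fun i => x i) (fun i => y i)) ∧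
    ((∃ i, i ∉ T ∧ x i ≠ y i) → E x y = 0)

/-- A quantum subsystem code in `(ℂ^q)^{⊗ n}` with a `K`-dimensional subsystem `A = ℂ^K` and an
`R`-dimensional gauge subsystem `B = ℂ^R`: a subspace with an identification with `A ⊗ B`, given as
the isometry `A ⊗ B → (ℂ^q)^{⊗ n}` with this subspace as its range. -/
structure SubsystemCode (q n K R : ℕ) where
  /-- The matrix of the isometry. -/
  encoder : Matrix (Fin n → Fin q) (Fin K × Fin R) ℂ
  isometry : encoderᴴ * encoder = 1

namespace SubsystemCode

variable {q n K R : ℕ}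

/-- The code detects the error operator `E`: compressed to the code space `A ⊗ B`, the operator
`E` acts as `1 ⊗ X` for some operator `X` on the gauge subsystem `B`. -/
def Detects (Q : SubsystemCode q n K R)
    (E : Matrix (Fin n → Fin q) (Fin n → Fin q) ℂ) : Prop :=
  ∃ X : Matrix (Fin R) (Fin R) ℂ,
    Q.encoderᴴ * E * Q.encoder = (1 : Matrix (Fin K) (Fin K) ℂ) ⊗ₖ X

/-- The code has minimum distance `δ`: it detects every error operator on fewer than `δ` positions
(so that it corrects, on the subsystem `A`, all errors on up to `⌊(δ - 1) / 2⌋` positions),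
and it fails to detect some error operator on `δ` positions. -/
def HasMinDist (Q : SubsystemCode q n K R) (δ : ℕ) : Prop :=
  (∀ (T : Finset (Fin n)) (E : Matrix (Fin n → Fin q) (Fin n → Fin q) ℂ),
      T.card < δ → ActsOn T E → Q.Detects E) ∧
  ∃ (T : Finset (Fin n)) (E : Matrix (Fin n → Fin q) (Fin n → Fin q) ℂ),
      T.card = δ ∧ ActsOn T E ∧ ¬ Q.Detects E

end SubsystemCode

/-- There is a quantum subsystem code with parameters `[[n, κ, r, δ]]_q`. -/
def ExistsSubsystemCode (q n κ r δ : ℕ) : Prop :=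
  ∃ Q : SubsystemCode q n (q ^ κ) (q ^ r), Q.HasMinDist δ

/-- The parameters `[[n, κ, r, δ]]` are optimal: equality holds in the Singleton-like bound
`κ + r ≤ n - 2 * δ + 2` (an equation between integers). -/
def IsOptimalParams (n κ r δ : ℕ) : Prop :=
  (κ : ℤ) + r = n - 2 * δ + 2

/-! Let `H` be the Hermitian hull of `C`, and delete a position `i` at which some vector of `H` is
nonzero. Then the unit vector at `i` is not in the dual of `H`, which contains `C`. Puncturing `C`
keeps its dimension, shortening lowers it by one, and in both cases the new hull is `H` shortened at
`i`, of dimension one less (`hermHull_puncture`, `hermHull_shorten`). So puncturing raises `r` by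
one and shortening raises `κ` by one. The dual of the new hull is the punctured dual of `H`
(`hermDual_shorten`), so weights drop by at most one. They drop by exactly one if `i` also lies in
the support of a minimum-weight vector; such an `i` exists when `2 ≤ δ`
(`exists_hull_apply_ne_zero`). Purity controls the vectors of `C` that shortening loses. Each
deletion raises both sides of the Singleton equality by one.

That these parameters belong to actual quantum codes is shown by Weyl operators `E v` whose
commutation phases are an additive character of the Hermitian form. Put `P = C` and `Q` its dual.
Maximal isotropic subgroups of `P` and of `Q` have together a common eigenstate, and its translates
by coset representatives form an orthonormal basis on which `P` moves only the gauge index and `Q`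
only the protected one. Hence `E v` is undetected exactly for `v` in the dual of `H` outside `C`
(`IsWeylSystem.exists_encoder`). Since Weyl operators supported in `T` span all operators on `T`
(`ActsOn.mem_span_weylMatrix`), the minimum distance is the weight `δ`. -/

section Classical

/-! ### Puncturing and shortening under the Hermitian form -/

variable {F : Type*} [Field F]

/-- Over the field with `q ^ 2` elements, `x ↦ x ^ q` is an involutive ring homomorphism. -/
theorem exists_ringHom_pow_involutive [Fintype F] {q : ℕ} (hq : IsPrimePow q)
    (hF : Fintype.card F = q ^ 2) :
    ∃ σ : F →+* F, (∀ x, σ x = x ^ q) ∧ ∀ x, σ (σ x) = x := by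
  obtain ⟨p, e, hp, he, rfl⟩ := hq
  rw [← Nat.prime_iff] at hp
  have hchar : CharP F p := by
    obtain ⟨p', hp'⟩ := CharP.exists F
    obtain ⟨m, hm1, hm2⟩ := FiniteField.card F p'
    have : p' = p := by
      rw [hm2] at hF
      have h1 : p' ∣ (p ^ e) ^ 2 := hF ▸ dvd_pow_self _ m.pos.ne'
      exact (Nat.prime_dvd_prime_iff_eq hm1 hp).1
        (hm1.dvd_of_dvd_pow (hm1.dvd_of_dvd_pow h1))
    exact this ▸ hp'
  have := Fact.mk hp
  refine ⟨iterateFrobenius F p e, fun x => iterateFrobenius_def p e x, fun x => ?_⟩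
  rw [iterateFrobenius_def, iterateFrobenius_def, ← pow_mul, ← sq, ← hF, FiniteField.pow_card]

variable {q : ℕ} {σ : F →+* F}

theorem hermInner_swap {n : ℕ} (hσ : ∀ x, σ x = x ^ q) (hσσ : ∀ x, σ (σ x) = x)
    (u v : Fin n → F) : σ (hermInner q u v) = hermInner q v u := by
  simp only [hermInner, ← hσ, map_sum, map_mul, hσσ]
  exact Finset.sum_congr rfl fun _ _ => mul_comm _ _

theorem hermInner_eq_zero_comm {n : ℕ} (hσ : ∀ x, σ x = x ^ q) (hσσ : ∀ x, σ (σ x) = x)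
    {u v : Fin n → F} : hermInner q u v = 0 ↔ hermInner q v u = 0 := by
  rw [← hermInner_swap hσ hσσ v u, map_eq_zero]

theorem hermInner_add_left {n : ℕ} (u v w : Fin n → F) :
    hermInner q (u + v) w = hermInner q u w + hermInner q v w := by
  simp [hermInner, add_mul, Finset.sum_add_distrib]

theorem hermInner_smul_left {n : ℕ} (c : F) (u v : Fin n → F) :
    hermInner q (c • u) v = c * hermInner q u v := by
  simp [hermInner, mul_assoc, Finset.mul_sum]

theorem hermInner_insertNth {n : ℕ} (i : Fin (n + 1)) (a b : F) (u v : Fin n → F) :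
    hermInner q (i.insertNth a u : Fin (n + 1) → F) (i.insertNth b v : Fin (n + 1) → F) =
      a * b ^ q + hermInner q u v := by
  simp [hermInner, Fin.sum_univ_succAbove _ i]

theorem hammingNorm_insertNth [DecidableEq F] {n : ℕ} (i : Fin (n + 1)) (a : F) (v : Fin n → F) :
    hammingNorm (i.insertNth a v : Fin (n + 1) → F) = (if a ≠ 0 then 1 else 0) + hammingNorm v := by
  simp only [hammingNorm, Finset.card_filter]
  simp [Fin.sum_univ_succAbove _ i]

theorem le_hermDual_hermHull {n : ℕ} (hσ : ∀ x, σ x = x ^ q) (hσσ : ∀ x, σ (σ x) = x)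
    (C : Submodule F (Fin n → F)) : C ≤ hermDual q (hermHull q C) := fun c hc _ hs =>
  (hermInner_eq_zero_comm hσ hσσ).1 (hs.2 c hc)

/-- The code punctured at the position `i`. -/
def puncture {n : ℕ} (i : Fin (n + 1)) (C : Submodule F (Fin (n + 1) → F)) :
    Submodule F (Fin n → F) :=
  C.map (LinearMap.funLeft F F i.succAbove)

/-- The code shortened at the position `i`. -/
def shorten {n : ℕ} (i : Fin (n + 1)) (C : Submodule F (Fin (n + 1) → F)) :
    Submodule F (Fin n → F) :=
  puncture i (C ⊓ LinearMap.ker (LinearMap.proj i))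

theorem mem_puncture {n : ℕ} {i : Fin (n + 1)} {C : Submodule F (Fin (n + 1) → F)}
    {v : Fin n → F} : v ∈ puncture i C ↔ ∃ a : F, (i.insertNth a v : Fin (n + 1) → F) ∈ C := by
  constructor
  · rintro ⟨u, hu, rfl⟩
    refine ⟨u i, ?_⟩
    rwa [show (i.insertNth (u i) (LinearMap.funLeft F F i.succAbove u) : Fin (n + 1) → F) = u from
      Fin.insertNth_self_removeNth i u]
  · rintro ⟨a, ha⟩
    refine ⟨_, ha, ?_⟩
    ext j
    simp [LinearMap.funLeft_apply]

theorem mem_shorten {n : ℕ} {i : Fin (n + 1)} {C : Submodule F (Fin (n + 1) → F)}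
    {v : Fin n → F} : v ∈ shorten i C ↔ (i.insertNth 0 v : Fin (n + 1) → F) ∈ C := by
  rw [shorten, mem_puncture]
  constructor
  · rintro ⟨a, h1, h2⟩
    obtain rfl : a = 0 := by simpa using h2
    exact h1
  · exact fun h => ⟨0, h, by simp⟩

/-- Clearing the coordinate `i` of `u` by means of a vector that does not vanish there. -/
theorem exists_insertNth_zero {n : ℕ} {i : Fin (n + 1)} {h : Fin (n + 1) → F} (hi : h i ≠ 0)
    (u : Fin (n + 1) → F) :
    ∃ (c : F) (u' : Fin n → F), u = (i.insertNth 0 u' : Fin (n + 1) → F) + c • h := by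
  refine ⟨u i / h i, i.removeNth (u - (u i / h i) • h), ?_⟩
  rw [Fin.insertNth_removeNth, ← sub_eq_iff_eq_add, eq_comm, Function.update_eq_self_iff]
  simp [hi]

theorem finrank_puncture {n : ℕ} {i : Fin (n + 1)} {C : Submodule F (Fin (n + 1) → F)}
    (h : ∀ a : F, (i.insertNth a 0 : Fin (n + 1) → F) ∈ C → a = 0) :
    Module.finrank F (puncture i C) = Module.finrank F C := by
  rw [puncture, ← LinearMap.range_domRestrict]
  refine LinearMap.finrank_range_of_inj ((injective_iff_map_eq_zero _).2 ?_)
  rintro ⟨u, hu⟩ h0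
  have h1 : (fun j => u (i.succAbove j)) = 0 := h0
  have h2 : (i.insertNth (u i) 0 : Fin (n + 1) → F) = u := by
    rw [← h1]; exact Fin.insertNth_self_removeNth i u
  have h3 := h (u i) (by rwa [h2])
  rw [h3] at h2
  ext j
  change u j = 0
  rw [← h2]
  refine Fin.succAboveCases i ?_ (fun k => ?_) j <;> simp

theorem finrank_shorten {n : ℕ} {i : Fin (n + 1)} {C : Submodule F (Fin (n + 1) → F)}
    {h : Fin (n + 1) → F} (hC : h ∈ C) (hi : h i ≠ 0) :
    Module.finrank F (shorten i C) + 1 = Module.finrank F C := by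
  have h1 : Module.finrank F (shorten i C) =
      Module.finrank F (C ⊓ LinearMap.ker (LinearMap.proj i) : Submodule F (Fin (n + 1) → F)) :=
    finrank_puncture fun a ha => by simpa using ha.2
  let f : C →ₗ[F] F := (LinearMap.proj i).domRestrict C
  have h2 : LinearMap.range f = ⊤ := by
    refine LinearMap.range_eq_top.2 fun a => ⟨(a / h i) • ⟨h, hC⟩, ?_⟩
    simp [f, hi]
  have h3 := LinearMap.finrank_range_add_finrank_ker f
  have h4 : (LinearMap.ker f).map C.subtype = C ⊓ LinearMap.ker (LinearMap.proj i) := by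
    rw [← Submodule.map_comap_subtype]; rfl
  rw [h2, finrank_top, Module.finrank_self, ← Submodule.finrank_map_subtype_eq, h4] at h3
  omega

/-- The dual of a punctured code is the shortened dual. If `v` lifts to `C` with entry `a` and to
the dual with entry `0`, both lifts are orthogonal to `h`, so `a * h i ^ q = 0` and `a = 0`. -/
theorem hermHull_puncture {n : ℕ} {i : Fin (n + 1)} {C : Submodule F (Fin (n + 1) → F)}
    (hσ : ∀ x, σ x = x ^ q) (hσσ : ∀ x, σ (σ x) = x)
    {h : Fin (n + 1) → F} (hC : h ∈ hermHull q C) (hi : h i ≠ 0) :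
    hermHull q (puncture i C) = shorten i (hermHull q C) := by
  have key : ∀ v, v ∈ hermDual q (puncture i C) ↔
      (i.insertNth 0 v : Fin (n + 1) → F) ∈ hermDual q C := by
    intro v
    constructor
    · intro hv c hc
      have hw : (i.insertNth (c i) (i.removeNth c) : Fin (n + 1) → F) = c :=
        Fin.insertNth_self_removeNth i c
      have h1 := hv _ (mem_puncture.2 ⟨c i, by rwa [hw]⟩)
      rwa [← hw, hermInner_insertNth, zero_mul, zero_add]
    · intro hv w hw
      obtain ⟨a, ha⟩ := mem_puncture.1 hw
      simpa [hermInner_insertNth] using hv _ ha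
  ext v
  rw [mem_shorten, hermHull, Submodule.mem_inf, key, hermHull, Submodule.mem_inf, mem_puncture]
  refine and_congr_left fun hv => ⟨?_, fun h0 => ⟨0, h0⟩⟩
  rintro ⟨a, ha⟩
  have h1 : hermInner q (i.insertNth a v : Fin (n + 1) → F) h = 0 :=
    le_hermDual_hermHull hσ hσσ C ha h hC
  have h2 : hermInner q (i.insertNth 0 v : Fin (n + 1) → F) h = 0 := hv h hC.1
  have hw : (i.insertNth (h i) (i.removeNth h) : Fin (n + 1) → F) = h :=
    Fin.insertNth_self_removeNth i h
  rw [← hw, hermInner_insertNth] at h1 h2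
  have h3 : a * h i ^ q = 0 := by linear_combination h1 - h2
  obtain rfl : a = 0 := by simpa [← hσ, hi] using h3
  exact ha

/-- Modulo `h` every vector of `C` vanishes at `i`, and `h`, being in the hull, is orthogonal to `C`
anyway; so orthogonality to the shortened code already gives orthogonality to `C`. -/
theorem hermHull_shorten {n : ℕ} {i : Fin (n + 1)} {C : Submodule F (Fin (n + 1) → F)}
    (hσ : ∀ x, σ x = x ^ q) (hσσ : ∀ x, σ (σ x) = x)
    {h : Fin (n + 1) → F} (hC : h ∈ hermHull q C) (hi : h i ≠ 0) :
    hermHull q (shorten i C) = shorten i (hermHull q C) := by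
  ext v
  rw [mem_shorten, hermHull, Submodule.mem_inf, hermHull, Submodule.mem_inf, mem_shorten]
  refine and_congr_right fun hv => ⟨fun hd c hc => ?_, fun hd w hw => ?_⟩
  · obtain ⟨b, c', rfl⟩ := exists_insertNth_zero hi c
    have hc' : (i.insertNth 0 c' : Fin (n + 1) → F) ∈ C := by
      have := C.sub_mem hc (C.smul_mem b hC.1)
      rwa [add_sub_cancel_right] at this
    have h1 := hd c' (mem_shorten.2 hc')
    rw [hermInner_eq_zero_comm hσ hσσ, hermInner_add_left, hermInner_smul_left,
      hermInner_insertNth, hC.2 _ hv, (hermInner_eq_zero_comm hσ hσσ).1 h1]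
    simp
  · have := hd _ (mem_shorten.1 hw)
    simpa [hermInner_insertNth] using this

theorem hermDual_shorten {n : ℕ} {i : Fin (n + 1)} {S : Submodule F (Fin (n + 1) → F)}
    (hσ : ∀ x, σ x = x ^ q) (hσσ : ∀ x, σ (σ x) = x)
    {h : Fin (n + 1) → F} (hS : h ∈ S) (hi : h i ≠ 0) :
    hermDual q (shorten i S) = puncture i (hermDual q S) := by
  ext v
  rw [mem_puncture]
  constructor
  · intro hv
    have hw : (i.insertNth (h i) (i.removeNth h) : Fin (n + 1) → F) = h :=
      Fin.insertNth_self_removeNth i h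
    have hiq : h i ^ q ≠ 0 := by rwa [← hσ, Ne, map_eq_zero]
    -- The entry at `i` is the solution of the single equation of orthogonality to `h`; the rest of
    -- `S` is spanned by `h` and vectors vanishing at `i`.
    refine ⟨-hermInner q v (i.removeNth h) / h i ^ q, fun s hs => ?_⟩
    obtain ⟨b, s', rfl⟩ := exists_insertNth_zero hi s
    have hs' : (i.insertNth 0 s' : Fin (n + 1) → F) ∈ S := by
      have := S.sub_mem hs (S.smul_mem b hS)
      rwa [add_sub_cancel_right] at this
    have h1 := (hermInner_eq_zero_comm hσ hσσ).1 (hv s' (mem_shorten.2 hs'))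
    have h2 : hermInner q h (i.insertNth (-hermInner q v (i.removeNth h) / h i ^ q) v :
        Fin (n + 1) → F) = 0 := by
      rw [hermInner_eq_zero_comm hσ hσσ]
      nth_rewrite 3 [← hw]
      rw [hermInner_insertNth]
      field_simp
      ring
    rw [hermInner_eq_zero_comm hσ hσσ, hermInner_add_left, hermInner_smul_left,
      hermInner_insertNth, h1, h2]
    simp
  · rintro ⟨a, ha⟩ w hw
    simpa [hermInner_insertNth, ← hσ] using ha _ (mem_shorten.1 hw)

/-- A dual vector outside `C` of minimum weight at least two meets the support of the hull. -/
theorem exists_hull_apply_ne_zero [DecidableEq F] {n : ℕ} {C : Submodule F (Fin n → F)} {δ : ℕ}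
    (hσ : ∀ x, σ x = x ^ q)
    (hd : IsMinWeight ((hermDual q (hermHull q C) : Set (Fin n → F)) \ (C : Set (Fin n → F))) δ)
    (hδ : 2 ≤ δ) {v : Fin n → F} (hv : v ∉ C) :
    ∃ i, v i ≠ 0 ∧ ∃ h ∈ hermHull q C, h i ≠ 0 := by
  by_contra! hcon
  refine hv ?_
  -- Where the hull vanishes on the support of `v`, each one-coordinate piece of `v` is in the dual
  -- of the hull. A nonzero piece has weight one, less than `δ`, so it lies in `C`; then so does
  -- `v`.
  rw [← Finset.univ_sum_single v]
  refine C.sum_mem fun i _ => ?_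
  by_cases hvi : v i = 0
  · rw [hvi, Pi.single_zero]; exact C.zero_mem
  by_contra hmem
  have h1 := hd.2 ⟨(Pi.single i (v i) : Fin n → F), ⟨fun s hs => ?_, hmem⟩,
    fun h0 => hmem (h0 ▸ C.zero_mem), rfl⟩
  · have h2 : hammingNorm (Pi.single i (v i) : Fin n → F) ≤ 1 := by
      have hsupp : ∀ c, (Pi.single i (v i) : Fin n → F) c ≠ 0 → c = i := fun c hc => by
        by_contra hci
        exact hc (Pi.single_eq_of_ne hci _)
      refine Finset.card_le_one.2 fun a ha b hb => ?_
      rw [hsupp a (Finset.mem_filter.1 ha).2, hsupp b (Finset.mem_filter.1 hb).2]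
    omega
  · refine Finset.sum_eq_zero fun j _ => ?_
    by_cases hij : j = i
    · subst hij; rw [hcon j hvi s hs, ← hσ, map_zero, mul_zero]
    · rw [Pi.single_eq_of_ne hij, zero_mul]

/-- Deleting one position, by puncturing or (for pure codes) by shortening. -/
theorem IsSubsystemParams.delete_succ [DecidableEq F] (hσ : ∀ x, σ x = x ^ q)
    (hσσ : ∀ x, σ (σ x) = x) {n κ r δ : ℕ} {C : Submodule F (Fin (n + 1) → F)}
    (hC : IsSubsystemParams q C κ r δ) (hδ : 2 ≤ δ) :
    (∃ C₁ : Submodule F (Fin n → F), IsSubsystemParams q C₁ κ (r + 1) (δ - 1)) ∧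
    (IsPureAt q C δ → ∃ C₂ : Submodule F (Fin n → F),
      IsSubsystemParams q C₂ (κ + 1) r (δ - 1) ∧ IsPureAt q C₂ (δ - 1)) := by
  obtain ⟨v, ⟨hvD, hvC⟩, hv0, hvδ⟩ := hC.dist.1
  obtain ⟨i, hvi, h, hh, hi⟩ := exists_hull_apply_ne_zero hσ hC.dist hδ hvC
  have hsplit : (i.insertNth (v i) (i.removeNth v) : Fin (n + 1) → F) = v :=
    Fin.insertNth_self_removeNth i v
  have hvD' : (i.insertNth (v i) (i.removeNth v) : Fin (n + 1) → F) ∈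
      hermDual q (hermHull q C) := by rwa [hsplit]
  have hnorm : hammingNorm (i.removeNth v) = δ - 1 := by
    rw [← hsplit, hammingNorm_insertNth, if_pos hvi] at hvδ
    omega
  have hle : ∀ (a : F) (w : Fin n → F),
      hammingNorm (i.insertNth a w : Fin (n + 1) → F) ≤ 1 + hammingNorm w := by
    intro a w
    rw [hammingNorm_insertNth]
    split_ifs <;> omega
  have hne : ∀ (a : F) {w : Fin n → F}, w ≠ 0 → (i.insertNth a w : Fin (n + 1) → F) ≠ 0 := by
    intro a w hw h0
    refine hw (funext fun j => ?_)
    simpa using congrFun h0 (i.succAbove j)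
  have hwv : i.removeNth v ≠ 0 := by
    rw [← hammingNorm_pos_iff]; omega
  -- the unit vector at `i` is not orthogonal to the hull
  have hunit : ∀ (a b : F) (w : Fin n → F),
      (i.insertNth a w : Fin (n + 1) → F) ∈ hermDual q (hermHull q C) →
      (i.insertNth b w : Fin (n + 1) → F) ∈ hermDual q (hermHull q C) → a = b := by
    intro a b w ha hb
    have h1 := ha h hh
    have h2 := hb h hh
    have hw : (i.insertNth (h i) (i.removeNth h) : Fin (n + 1) → F) = h :=
      Fin.insertNth_self_removeNth i h
    rw [← hw, hermInner_insertNth] at h1 h2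
    have h3 : (a - b) * h i ^ q = 0 := by linear_combination h1 - h2
    have h4 : a - b = 0 := by simpa [← hσ, hi] using h3
    exact sub_eq_zero.1 h4
  have hCD := le_hermDual_hermHull hσ hσσ C
  have hS := finrank_shorten hh hi
  have hlt := hC.lt
  have hκ := hC.kappa
  have hg := hC.gauge
  refine ⟨⟨puncture i C, ?_⟩, fun hpure => ⟨shorten i C, ?_, ?_⟩⟩
  · have hull := hermHull_puncture hσ hσσ hh hi
    have hdim : Module.finrank F (puncture i C) = Module.finrank F C := by
      refine finrank_puncture fun a ha => hunit a 0 0 (hCD ha) ?_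
      convert (hermDual q (hermHull q C)).zero_mem
      ext j
      refine Fin.succAboveCases i ?_ (fun k => ?_) j <;> simp
    refine ⟨by rw [hull]; omega, by rw [hull]; omega, by rw [hull]; omega, ?_⟩
    rw [hull, hermDual_shorten hσ hσσ hh hi]
    refine ⟨⟨i.removeNth v, ⟨mem_puncture.2 ⟨v i, hvD'⟩, fun hmem => ?_⟩, hwv, hnorm⟩, ?_⟩
    · obtain ⟨a, ha⟩ := mem_puncture.1 hmem
      -- A vector of the dual of the hull is determined by its entries off `i`, so a lift of the
      -- punctured `v` to `C` would be `v` itself.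
      rw [hunit a (v i) _ (hCD ha) hvD', hsplit] at ha
      exact hvC ha
    · rintro m ⟨w, ⟨hw1, hw2⟩, hw0, rfl⟩
      obtain ⟨a, ha⟩ := mem_puncture.1 hw1
      have := hC.dist.2 ⟨_, ⟨ha, fun h' => hw2 (mem_puncture.2 ⟨a, h'⟩)⟩, hne a hw0, rfl⟩
      have := hle a w
      omega
  all_goals
    have hull := hermHull_shorten hσ hσσ hh hi
    have hdim := finrank_shorten hh.1 hi
    -- Words of `C` that are nonzero at `i` do not survive into the shortened code, so the lift of
    -- `w` may lie in `C`; purity bounds its weight all the same.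
    have hpos : δ - 1 ∈ lowerBounds {m : ℕ | ∃ w ∈ (puncture i (hermDual q (hermHull q C)) :
        Set (Fin n → F)), w ≠ 0 ∧ hammingNorm w = m} := by
      rintro m ⟨w, hw1, hw0, rfl⟩
      obtain ⟨a, ha⟩ := mem_puncture.1 hw1
      have := hpure.2 ⟨_, ha, hne a hw0, rfl⟩
      have := hle a w
      omega
    have hvP : i.removeNth v ∈ puncture i (hermDual q (hermHull q C)) :=
      mem_puncture.2 ⟨v i, hvD'⟩
  · refine ⟨by rw [hull]; omega, by rw [hull]; omega, by rw [hull]; omega, ?_⟩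
    rw [hull, hermDual_shorten hσ hσσ hh hi]
    refine ⟨⟨i.removeNth v, ⟨hvP, fun hmem => ?_⟩, hwv, hnorm⟩,
      fun m ⟨w, hw, hm⟩ => hpos ⟨w, hw.1, hm⟩⟩
    exact hvi (hunit (v i) 0 _ hvD' (hCD (mem_shorten.1 hmem)))
  · rw [IsPureAt, hull, hermDual_shorten hσ hσσ hh hi]
    exact ⟨⟨i.removeNth v, hvP, hwv, hnorm⟩, hpos⟩

theorem IsSubsystemParams.delete [DecidableEq F] (hσ : ∀ x, σ x = x ^ q)
    (hσσ : ∀ x, σ (σ x) = x) {n κ r δ : ℕ} {C : Submodule F (Fin n → F)}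
    (hC : IsSubsystemParams q C κ r δ) (hδ : 2 ≤ δ) :
    (∃ C₁ : Submodule F (Fin (n - 1) → F), IsSubsystemParams q C₁ κ (r + 1) (δ - 1)) ∧
    (IsPureAt q C δ → ∃ C₂ : Submodule F (Fin (n - 1) → F),
      IsSubsystemParams q C₂ (κ + 1) r (δ - 1) ∧ IsPureAt q C₂ (δ - 1)) := by
  cases n with
  | zero => exact absurd hC.lt (Nat.not_lt_zero _)
  | succ n => exact hC.delete_succ hσ hσσ hδ

/-- Purity appears in the second conclusion because the next shortening needs it. The lengths `n - s
- 1` and `n - (s + 1)` agree definitionally, so codes need no transport. -/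
theorem IsSubsystemParams.delete_iterate [DecidableEq F] (hσ : ∀ x, σ x = x ^ q)
    (hσσ : ∀ x, σ (σ x) = x) {n κ r δ : ℕ} {C : Submodule F (Fin n → F)}
    (hC : IsSubsystemParams q C κ r δ) (s : ℕ) (hs : s + 1 ≤ δ) :
    (∃ C₁ : Submodule F (Fin (n - s) → F), IsSubsystemParams q C₁ κ (r + s) (δ - s)) ∧
    (IsPureAt q C δ → ∃ C₂ : Submodule F (Fin (n - s) → F),
      IsSubsystemParams q C₂ (κ + s) r (δ - s) ∧ IsPureAt q C₂ (δ - s)) := by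
  induction s with
  | zero => exact ⟨⟨C, hC⟩, fun h => ⟨C, hC, h⟩⟩
  | succ s ih =>
    obtain ⟨⟨C₁, h1⟩, h2⟩ := ih (by omega)
    refine ⟨(h1.delete hσ hσσ (by omega)).1, fun hp => ?_⟩
    obtain ⟨C₂, h3, h4⟩ := h2 hp
    exact (h3.delete hσ hσσ (by omega)).2 h4

end Classical

/-! ### Symplectic characters and isotropic subgroups -/

section SymplecticCharacter

variable {V : Type*} [AddCommGroup V]

/-- A nondegenerate alternating bicharacter on a finite abelian group. -/
structure IsSymplecticChar (χ : V → AddChar V ℂ) : Prop where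
  add_left : ∀ u v w, χ (u + v) w = χ u w * χ v w
  self : ∀ u, χ u u = 1
  nondeg : ∀ u, (∀ v, χ u v = 1) → u = 0

namespace IsSymplecticChar

variable {χ : V → AddChar V ℂ}

theorem zero_left (h : IsSymplecticChar χ) (v : V) : χ 0 v = 1 := by
  have h1 := h.add_left 0 v v
  rw [zero_add, h.self, mul_one] at h1
  exact h1.symm

theorem swap_mul (h : IsSymplecticChar χ) (u v : V) : χ u v * χ v u = 1 := by
  have h1 := h.self (u + v)
  rw [h.add_left, AddChar.map_add_eq_mul, AddChar.map_add_eq_mul, h.self, h.self, one_mul,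
    mul_one] at h1
  exact h1

theorem swap_eq_one (h : IsSymplecticChar χ) {u v : V} : χ u v = 1 ↔ χ v u = 1 := by
  have h1 := h.swap_mul u v
  constructor <;> intro h2 <;> simpa [h2] using h1

theorem neg_left (h : IsSymplecticChar χ) (u v : V) : χ (-u) v * χ u v = 1 := by
  rw [← h.add_left, neg_add_cancel, h.zero_left]

/-- The elements on which all characters coming from `W` are trivial. -/
def perp (h : IsSymplecticChar χ) (W : AddSubgroup V) : AddSubgroup V where
  carrier := {u | ∀ v ∈ W, χ u v = 1}
  zero_mem' := fun v _ => h.zero_left v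
  add_mem' := fun {a b} ha hb v hv => by rw [h.add_left, ha v hv, hb v hv, one_mul]
  neg_mem' := fun {a} ha v hv => by
    have h1 := h.neg_left a v
    rwa [ha v hv, mul_one] at h1

theorem mem_perp (h : IsSymplecticChar χ) {W : AddSubgroup V} {u : V} :
    u ∈ h.perp W ↔ ∀ v ∈ W, χ u v = 1 := Iff.rfl

/-- Evaluate the sum of `χ v w` over `V × W` in both orders: by orthogonality of characters, the
inner sum over `W` detects `perp W`, while the inner sum over `V` detects `w = 0`. -/
theorem card_perp_mul_card [Finite V] (h : IsSymplecticChar χ) (W : AddSubgroup V) :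
    Nat.card (h.perp W) * Nat.card W = Nat.card V := by
  classical
  have := Fintype.ofFinite V
  have h1 : ∀ v : V, ∑ w : W, χ v w = if v ∈ h.perp W then (Nat.card W : ℂ) else 0 := by
    intro v
    have h2 := AddChar.sum_eq_ite ((χ v).compAddMonoidHom W.subtype)
    have h3 : (χ v).compAddMonoidHom W.subtype = 0 ↔ v ∈ h.perp W := by
      rw [DFunLike.ext_iff, mem_perp]
      simp
    simpa [h3] using h2
  have h2 : ∀ w : V, ∑ v : V, χ v w = if w = 0 then (Nat.card V : ℂ) else 0 := by
    intro w
    have h3 := AddChar.sum_eq_ite (χ w)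
    have h4 : χ w = 0 ↔ w = 0 := by
      rw [DFunLike.ext_iff]
      refine ⟨fun h0 => h.nondeg w fun v => by simpa using h0 v, ?_⟩
      rintro rfl v
      simpa using h.zero_left v
    -- Since `χ (-v) w = χ w v`, the substitution turns a sum over the first argument into a sum of
    -- the character `χ w`.
    rw [← Equiv.sum_comp (Equiv.neg V)]
    rw [← Nat.card_eq_fintype_card] at h3
    simp only [h4] at h3
    rw [← h3]
    refine Finset.sum_congr rfl fun v _ => ?_
    have h5 := h.neg_left v w
    have h6 := h.swap_mul v w
    have h7 : χ v w ≠ 0 := left_ne_zero_of_mul_eq_one h6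
    rw [mul_comm] at h5
    exact mul_left_cancel₀ h7 (h5.trans h6.symm)
  have h3 : ∑ v : V, ∑ w : W, χ v w = ∑ w : W, ∑ v : V, χ v w := Finset.sum_comm
  simp only [h1, h2] at h3
  rw [← Finset.sum_filter, Finset.sum_const] at h3
  have h4 : (Finset.univ.filter (· ∈ h.perp W)).card = Nat.card (h.perp W) := by
    rw [Nat.card_eq_fintype_card, Fintype.card_subtype]
  rw [h4] at h3
  simp only [ZeroMemClass.coe_eq_zero, Finset.sum_ite_eq', Finset.mem_univ, if_true,
    nsmul_eq_mul] at h3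
  exact_mod_cast h3

theorem le_perp_perp (h : IsSymplecticChar χ) (W : AddSubgroup V) : W ≤ h.perp (h.perp W) :=
  fun _ hu _ hv => h.swap_eq_one.1 (hv _ hu)

theorem perp_perp [Finite V] (h : IsSymplecticChar χ) (W : AddSubgroup V) :
    h.perp (h.perp W) = W := by
  have h1 := h.card_perp_mul_card W
  have h2 := h.card_perp_mul_card (h.perp W)
  have h3 : 0 < Nat.card (h.perp W) := Nat.card_pos
  refine (AddSubgroup.eq_of_le_of_card_ge (h.le_perp_perp W) ?_).symm
  rw [mul_comm, ← h2] at h1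
  exact (Nat.eq_of_mul_eq_mul_right h3 h1).ge

theorem perp_sup (h : IsSymplecticChar χ) (W W' : AddSubgroup V) :
    h.perp (W ⊔ W') = h.perp W ⊓ h.perp W' := by
  ext u
  constructor
  · exact fun hu => ⟨fun v hv => hu v (le_sup_left (a := W) hv),
      fun v hv => hu v (le_sup_right (a := W) hv)⟩
  · rintro ⟨h1, h2⟩ v hv
    obtain ⟨a, ha, b, hb, rfl⟩ := AddSubgroup.mem_sup.1 hv
    rw [AddChar.map_add_eq_mul, h1 a ha, h2 b hb, one_mul]

/-- A maximal isotropic subgroup of `P`. -/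
theorem exists_maximal_isotropic [Finite V] (h : IsSymplecticChar χ) (P : AddSubgroup V) :
    ∃ L : AddSubgroup V, L = h.perp L ⊓ P := by
  obtain ⟨L, hL⟩ := (Set.toFinite {L : AddSubgroup V | L ≤ h.perp L ⊓ P}).exists_maximal
    ⟨⊥, (bot_le : (⊥ : AddSubgroup V) ≤ _)⟩
  refine ⟨L, le_antisymm hL.1 fun v hv => ?_⟩
  -- Adjoining `v` keeps `L` isotropic because `χ v v = 1`; maximality then puts `v` in `L`.
  have h1 : L ⊔ AddSubgroup.zmultiples v ≤ h.perp (L ⊔ AddSubgroup.zmultiples v) ⊓ P := by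
    have hvz : ∀ u, χ u v = 1 → ∀ m : ℤ, χ u (m • v) = 1 := fun u hu m => by
      rw [AddChar.map_zsmul_eq_zpow, hu, one_zpow]
    have hz : AddSubgroup.zmultiples v ≤ h.perp (AddSubgroup.zmultiples v) := by
      rw [AddSubgroup.zmultiples_le]
      rintro _ ⟨m, rfl⟩
      exact hvz v (h.self v) m
    have hz' : AddSubgroup.zmultiples v ≤ h.perp L := by
      rw [AddSubgroup.zmultiples_le]
      exact hv.1
    have hz'' : L ≤ h.perp (AddSubgroup.zmultiples v) := by
      rintro u hu _ ⟨m, rfl⟩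
      exact hvz u (h.swap_eq_one.1 (hv.1 u hu)) m
    rw [h.perp_sup]
    refine le_inf (le_inf (sup_le (hL.1.trans inf_le_left) hz') (sup_le hz'' hz))
      (sup_le (hL.1.trans inf_le_right) ?_)
    rw [AddSubgroup.zmultiples_le]
    exact hv.2
  exact hL.2 h1 le_sup_left (AddSubgroup.mem_sup_right (AddSubgroup.mem_zmultiples v))

theorem card_sup_mul_card_inf [Finite V] (A B : AddSubgroup V) :
    Nat.card (A ⊔ B : AddSubgroup V) * Nat.card (A ⊓ B : AddSubgroup V) =
      Nat.card A * Nat.card B := by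
  have h1 := AddSubgroup.relIndex_sup_right A B
  have h2 := AddSubgroup.relIndex_mul_relIndex (⊥ : AddSubgroup V) B (A ⊔ B) bot_le le_sup_right
  have h3 := AddSubgroup.relIndex_mul_relIndex (⊥ : AddSubgroup V) (A ⊓ B) A bot_le inf_le_left
  have h4 := AddSubgroup.inf_relIndex_left A B
  simp only [AddSubgroup.relIndex_bot_left] at h2 h3
  rw [← h2, ← h3, h1, h4]
  ring

/-- For a pair of mutually orthogonal subgroups `P` and `Q`, a maximal isotropic subgroup `L` of `P`
satisfies `|P : L| ^ 2 = |P : P ∩ Q|`. -/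
theorem card_isotropic [Finite V] (h : IsSymplecticChar χ) {P Q L : AddSubgroup V}
    (hPQ : h.perp P = Q) (hL : L = h.perp L ⊓ P) :
    Nat.card L ^ 2 * Nat.card Q = Nat.card V * Nat.card (P ⊓ Q : AddSubgroup V) := by
  have hQP : h.perp Q = P := by rw [← hPQ, h.perp_perp]
  -- The count follows from the order of `L ⊔ Q`: its perp is `L`, and its two summands meet in `P ⊓
  -- Q`, which maximality forces into `L`.
  have h1 : h.perp (L ⊔ Q) = L := by rw [h.perp_sup, hQP, ← hL]
  have hLP : L ≤ P := by rw [hL]; exact inf_le_right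
  have h2 : L ⊓ Q = P ⊓ Q := by
    refine le_antisymm (inf_le_inf_right _ hLP) (le_inf ?_ inf_le_right)
    rw [hL]
    refine le_inf (fun u hu v hv => ?_) inf_le_left
    rw [inf_comm, ← hPQ] at hu
    exact hu.1 v (hLP hv)
  have h3 := h.card_perp_mul_card (L ⊔ Q)
  have h4 := card_sup_mul_card_inf L Q
  rw [h1] at h3
  rw [h2] at h4
  rw [← h3, mul_assoc, h4]
  ring

end IsSymplecticChar

/-- Coset representatives of `L` in `P`, indexed by `Fin K`. -/
theorem exists_coset_representatives [Finite V] {L P : AddSubgroup V} {K : ℕ} (hLP : L ≤ P)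
    (hK : Nat.card P = K * Nat.card L) :
    ∃ a : Fin K → V, (∀ i, a i ∈ P) ∧ (∀ v ∈ P, ∃ i, v - a i ∈ L) ∧
      ∀ i j, a i - a j ∈ L → i = j := by
  have h1 := AddSubgroup.card_mul_index (L.addSubgroupOf P)
  have h2 : Nat.card (L.addSubgroupOf P) = Nat.card L :=
    Nat.card_congr (AddSubgroup.addSubgroupOfEquivOfLe hLP).toEquiv
  have h3 : Nat.card (P ⧸ L.addSubgroupOf P) = K := by
    rw [h2, hK, mul_comm] at h1
    exact Nat.eq_of_mul_eq_mul_right Nat.card_pos h1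
  let e : Fin K ≃ P ⧸ L.addSubgroupOf P := (Finite.equivFinOfCardEq h3).symm
  refine ⟨fun i => ((e i).out : P), fun i => (e i).out.2, fun v hv => ?_, fun i j hij => ?_⟩
  · refine ⟨e.symm (QuotientAddGroup.mk ⟨v, hv⟩), ?_⟩
    have h4 := Quotient.out_eq' (e (e.symm (QuotientAddGroup.mk ⟨v, hv⟩)))
    change v - ((e (e.symm (QuotientAddGroup.mk ⟨v, hv⟩))).out : P) ∈ L
    rw [Equiv.apply_symm_apply] at h4 ⊢
    have h5 := QuotientAddGroup.eq.1 h4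
    rw [AddSubgroup.mem_addSubgroupOf] at h5
    convert h5 using 1
    simp [sub_eq_neg_add]
  · have h4 : (QuotientAddGroup.mk (e j).out : P ⧸ L.addSubgroupOf P) =
        QuotientAddGroup.mk (e i).out := by
      rw [QuotientAddGroup.eq, AddSubgroup.mem_addSubgroupOf]
      convert hij using 1
      simp [sub_eq_neg_add]
    have h5 : e j = e i := by
      rw [← Quotient.out_eq' (e j), ← Quotient.out_eq' (e i)]
      exact h4
    exact (e.injective h5).symm

end SymplecticCharacter

/-! ### Weyl systems and the encoder -/

/-- Pairwise commuting operators on a nonzero finite-dimensional complex space have a common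
eigenvector. -/
theorem exists_common_eigenvector {H ι : Type*} [AddCommGroup H] [Module ℂ H]
    [FiniteDimensional ℂ H] [Nontrivial H] (T : ι → Module.End ℂ H)
    (hT : ∀ i j, Commute (T i) (T j)) : ∃ x : H, x ≠ 0 ∧ ∀ i, ∃ c : ℂ, T i x = c • x := by
  -- On a minimal nonzero invariant subspace every operator is scalar, since its eigenspaces there
  -- are again invariant under all the others.
  obtain ⟨W, hW⟩ := WellFounded.has_min (wellFounded_lt (α := Submodule ℂ H))
    {W | W ≠ ⊥ ∧ ∀ i, ∀ x ∈ W, T i x ∈ W} ⟨⊤, top_ne_bot, fun _ _ _ => trivial⟩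
  obtain ⟨⟨hW0, hWT⟩, hmin⟩ := hW
  obtain ⟨x, hxW, hx0⟩ := W.ne_bot_iff.1 hW0
  refine ⟨x, hx0, fun i => ?_⟩
  have : Nontrivial W := Submodule.nontrivial_iff_ne_bot.2 hW0
  obtain ⟨c, hc⟩ := Module.End.exists_eigenvalue ((T i).restrict (hWT i))
  obtain ⟨y, hy⟩ := hc.exists_hasEigenvector
  have hy' : T i y = c • (y : H) := congrArg Subtype.val hy.apply_eq_smul
  refine ⟨c, ?_⟩
  by_contra hne
  refine hmin (W ⊓ LinearMap.ker (T i - c • 1)) ⟨?_, ?_⟩ ?_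
  · refine (Submodule.ne_bot_iff _).2 ⟨y, ⟨y.2, ?_⟩, fun h0 => hy.2 (Subtype.ext h0)⟩
    simp [hy']
  · rintro j z ⟨hz1, hz2⟩
    refine ⟨hWT j z hz1, ?_⟩
    have hz3 : T i z = c • z := by simpa [sub_eq_zero] using hz2
    have h5 : T i (T j z) = T j (T i z) := LinearMap.congr_fun (hT i j) z
    simp [h5, hz3]
  · refine lt_of_le_of_ne inf_le_left fun heq => hne ?_
    have h6 : x ∈ W ⊓ LinearMap.ker (T i - c • 1) := by rwa [heq]
    simpa [sub_eq_zero] using h6.2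

section WeylSystem

variable {V I : Type*} [AddCommGroup V] [Fintype I] [DecidableEq I]

/-- Unitary matrices indexed by a finite abelian group that form a projective representation with
the commutation relations given by `χ`. -/
structure IsWeylSystem (χ : V → AddChar V ℂ) (E : V → Matrix I I ℂ) : Prop where
  unitary : ∀ v, (E v)ᴴ * E v = 1
  mul : ∀ u v, ∃ c : ℂ, c ≠ 0 ∧ E u * E v = c • E (u + v)
  comm : ∀ u v, E u * E v = χ u v • (E v * E u)

namespace IsWeylSystem

variable {χ : V → AddChar V ℂ} {E : V → Matrix I I ℂ}

theorem mulVec_comm (hE : IsWeylSystem χ E) (u v : V) (x : I → ℂ) :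
    E u *ᵥ (E v *ᵥ x) = χ u v • (E v *ᵥ (E u *ᵥ x)) := by
  rw [Matrix.mulVec_mulVec, Matrix.mulVec_mulVec, hE.comm, Matrix.smul_mulVec]

theorem dotProduct_mulVec (hE : IsWeylSystem χ E) (v : V) (x y : I → ℂ) :
    star (E v *ᵥ x) ⬝ᵥ (E v *ᵥ y) = star x ⬝ᵥ y := by
  rw [Matrix.star_mulVec, ← Matrix.dotProduct_mulVec, Matrix.mulVec_mulVec, hE.unitary,
    Matrix.one_mulVec]

-- On `S` the operators commute, so they share an eigenvector; unitarity makes the eigenvalues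
-- phases, which the orthogonality arguments for the encoder need.
open scoped ComplexOrder in
theorem exists_eigenvector [Nonempty I] (hE : IsWeylSystem χ E) (S : Set V)
    (hS : ∀ u ∈ S, ∀ v ∈ S, χ u v = 1) :
    ∃ ψ : I → ℂ, star ψ ⬝ᵥ ψ = 1 ∧ ∀ v ∈ S, ∃ c : ℂ, star c * c = 1 ∧ E v *ᵥ ψ = c • ψ := by
  obtain ⟨x, hx0, hx⟩ := exists_common_eigenvector (fun v : S => Matrix.toLin' (E v)) (by
    intro u v
    rw [Commute, SemiconjBy, Module.End.mul_eq_comp, Module.End.mul_eq_comp,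
      ← Matrix.toLin'_mul, ← Matrix.toLin'_mul, hE.comm, hS u u.2 v v.2, one_smul])
  have hpos : 0 < star x ⬝ᵥ x := Matrix.dotProduct_star_self_pos_iff.2 hx0
  obtain ⟨t, ht0, ht⟩ : ∃ t : ℝ, 0 < t ∧ (t : ℂ) = star x ⬝ᵥ x := by
    obtain ⟨h1, h2⟩ := Complex.lt_def.1 hpos
    exact ⟨_, h1, Complex.ext rfl h2⟩
  have hnorm : star (((Real.sqrt t)⁻¹ : ℂ) • x) ⬝ᵥ (((Real.sqrt t)⁻¹ : ℂ) • x) = 1 := by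
    rw [star_smul, smul_dotProduct, dotProduct_smul, ← ht, smul_eq_mul, smul_eq_mul,
      ← Complex.ofReal_inv]
    have h3 : star (((Real.sqrt t)⁻¹ : ℝ) : ℂ) = (((Real.sqrt t)⁻¹ : ℝ) : ℂ) :=
      Complex.conj_ofReal _
    rw [h3]
    norm_cast
    have h4 := Real.mul_self_sqrt ht0.le
    have h5 := (Real.sqrt_pos.2 ht0).ne'
    nth_rewrite 3 [← h4]
    field_simp
  refine ⟨_, hnorm, fun v hv => ?_⟩
  obtain ⟨c, hc⟩ := hx ⟨v, hv⟩
  have hc' : E v *ᵥ (((Real.sqrt t)⁻¹ : ℂ) • x) = c • (((Real.sqrt t)⁻¹ : ℂ) • x) := by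
    rw [Matrix.mulVec_smul, smul_comm c]
    congr 1
  refine ⟨c, ?_, hc'⟩
  have h6 := hE.dotProduct_mulVec v (((Real.sqrt t)⁻¹ : ℂ) • x) (((Real.sqrt t)⁻¹ : ℂ) • x)
  rwa [hc', star_smul c, smul_dotProduct, dotProduct_smul, hnorm, smul_eq_mul, smul_eq_mul,
    mul_one] at h6

/-- Applied to a state stabilized by `L`, an element of `P` permutes the states of the cosets of `L`
up to phases. -/
theorem exists_mulVec_representative (hE : IsWeylSystem χ E) {L P : AddSubgroup V}
    {ψ : I → ℂ} (hψ : ∀ v ∈ L, ∃ c : ℂ, E v *ᵥ ψ = c • ψ) {K : ℕ} {a : Fin K → V}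
    (ha : ∀ i, a i ∈ P) (ha' : ∀ v ∈ P, ∃ i, v - a i ∈ L) {v : V} (hv : v ∈ P) (i : Fin K) :
    ∃ (j : Fin K) (c : ℂ), E v *ᵥ (E (a i) *ᵥ ψ) = c • (E (a j) *ᵥ ψ) := by
  obtain ⟨j, hj⟩ := ha' _ (P.add_mem hv (ha i))
  obtain ⟨c, hc⟩ := hψ _ hj
  obtain ⟨c₁, -, h1⟩ := hE.mul v (a i)
  obtain ⟨c₂, h2, h3⟩ := hE.mul (a j) (v + a i - a j)
  rw [add_sub_cancel] at h3
  refine ⟨j, c₁ * (c₂⁻¹ * c), ?_⟩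
  have h4 : E (v + a i) = c₂⁻¹ • (E (a j) * E (v + a i - a j)) := by
    rw [h3, smul_smul, inv_mul_cancel₀ h2, one_smul]
  rw [Matrix.mulVec_mulVec, h1, h4, Matrix.smul_mulVec, Matrix.smul_mulVec,
    ← Matrix.mulVec_mulVec, hc, Matrix.mulVec_smul, smul_smul, smul_smul, mul_assoc]

/-- The encoder of the subsystem code given by a pair of mutually orthogonal subgroups `P` (the
gauge operators) and `Q` (the operators on the protected subsystem). -/
theorem exists_encoder [Finite V] [Nonempty I] (hE : IsWeylSystem χ E) (hχ : IsSymplecticChar χ)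
    {P Q : AddSubgroup V} (hPQ : hχ.perp P = Q) {K R : ℕ}
    (hQ : Nat.card Q = K ^ 2 * Nat.card (P ⊓ Q : AddSubgroup V))
    (hP : Nat.card P = R ^ 2 * Nat.card (P ⊓ Q : AddSubgroup V)) :
    ∃ W : Matrix I (Fin K × Fin R) ℂ, Wᴴ * W = 1 ∧
      ∀ v, (∃ X : Matrix (Fin R) (Fin R) ℂ,
        Wᴴ * E v * W = (1 : Matrix (Fin K) (Fin K) ℂ) ⊗ₖ X) ↔
          (v ∈ hχ.perp (P ⊓ Q) → v ∈ P) := by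
  have hQP : hχ.perp Q = P := by rw [← hPQ, hχ.perp_perp]
  have hcard := hχ.card_perp_mul_card P
  rw [hPQ] at hcard
  obtain ⟨A, hA⟩ := hχ.exists_maximal_isotropic Q
  obtain ⟨B, hB⟩ := hχ.exists_maximal_isotropic P
  have hAQ : A ≤ Q := by rw [hA]; exact inf_le_right
  have hBP : B ≤ P := by rw [hB]; exact inf_le_right
  have hAcard := hχ.card_isotropic hQP hA
  have hBcard := hχ.card_isotropic hPQ hB
  rw [inf_comm] at hAcard
  have hS0 : 0 < Nat.card (P ⊓ Q : AddSubgroup V) := Nat.card_pos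
  have hP0 : 0 < Nat.card P := Nat.card_pos
  have hQ0 : 0 < Nat.card Q := Nat.card_pos
  have hK0 : 0 < K := by
    rcases Nat.eq_zero_or_pos K with rfl | h
    · simp at hQ; omega
    · exact h
  have hR0 : 0 < R := by
    rcases Nat.eq_zero_or_pos R with rfl | h
    · simp at hP; omega
    · exact h
  have hAK : Nat.card Q = K * Nat.card A := by
    have h1 : Nat.card A ^ 2 = (K * Nat.card (P ⊓ Q : AddSubgroup V)) ^ 2 := by
      refine Nat.eq_of_mul_eq_mul_right hP0 ?_
      rw [hAcard, ← hcard, hQ]; ring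
    rw [Nat.pow_left_injective two_ne_zero h1, hQ]; ring
  have hBR : Nat.card P = R * Nat.card B := by
    have h1 : Nat.card B ^ 2 = (R * Nat.card (P ⊓ Q : AddSubgroup V)) ^ 2 := by
      refine Nat.eq_of_mul_eq_mul_right hQ0 ?_
      rw [hBcard, ← hcard, hP]; ring
    rw [Nat.pow_left_injective two_ne_zero h1, hP]; ring
  have hcross : ∀ u ∈ P, ∀ v ∈ Q, χ u v = 1 := fun u hu v hv => by
    rw [← hQP] at hu; exact hu v hv
  have hcross' : ∀ u ∈ P, ∀ v ∈ Q, χ v u = 1 := fun u hu v hv =>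
    hχ.swap_eq_one.1 (hcross u hu v hv)
  obtain ⟨α, hαQ, hα, hαinj⟩ := exists_coset_representatives hAQ hAK
  obtain ⟨β, hβP, hβ, hβinj⟩ := exists_coset_representatives hBP hBR
  obtain ⟨ψ, hψ1, hψ⟩ := hE.exists_eigenvector ((A : Set V) ∪ B) (by
    rintro u (hu | hu) v (hv | hv)
    · have hu' : u ∈ A := hu
      rw [hA] at hu'
      exact hu'.1 v hv
    · exact hcross' v (hBP hv) u (hAQ hu)
    · exact hcross u (hBP hu) v (hAQ hv)
    · have hu' : u ∈ B := hu
      rw [hB] at hu'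
      exact hu'.1 v hv)
  have hψA : ∀ v ∈ A, ∃ c : ℂ, star c * c = 1 ∧ E v *ᵥ ψ = c • ψ := fun v hv => hψ v (Or.inl hv)
  have hψB : ∀ v ∈ B, ∃ c : ℂ, star c * c = 1 ∧ E v *ᵥ ψ = c • ψ := fun v hv => hψ v (Or.inr hv)
  -- `A` and `B` commute elementwise, so `ψ` is stabilized up to phases by both; its translates by
  -- coset representatives of `Q / A` and `P / B` are the encoded basis states.
  let col : Fin K × Fin R → I → ℂ := fun ab => E (α ab.1) *ᵥ (E (β ab.2) *ᵥ ψ)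
  let W : Matrix I (Fin K × Fin R) ℂ := Matrix.of fun i ab => col ab i
  have hmulW : ∀ (M : Matrix I I ℂ) (i : I) (ab : Fin K × Fin R),
      (M * W) i ab = (M *ᵥ col ab) i := fun M i ab => rfl
  have hcol : ∀ (l : V) (c : ℂ), E l *ᵥ ψ = c • ψ → ∀ ab,
      E l *ᵥ col ab = (χ l (α ab.1) * χ l (β ab.2) * c) • col ab := by
    intro l c hc ab
    simp only [col]
    rw [hE.mulVec_comm, hE.mulVec_comm l (β ab.2), hc, Matrix.mulVec_smul, Matrix.mulVec_smul,
      Matrix.mulVec_smul, smul_smul, smul_smul]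
  -- Eigenvectors of a unitary for different eigenvalues are orthogonal.
  have horth : ∀ (l : V) (c : ℂ), star c * c = 1 → E l *ᵥ ψ = c • ψ → ∀ ab ab',
      star (χ l (α ab.1) * χ l (β ab.2)) * (χ l (α ab'.1) * χ l (β ab'.2)) ≠ 1 →
      star (col ab) ⬝ᵥ col ab' = 0 := by
    intro l c hc hl ab ab' hne
    have h1 := hE.dotProduct_mulVec l (col ab) (col ab')
    rw [hcol l c hl, hcol l c hl, star_smul, smul_dotProduct, dotProduct_smul, smul_eq_mul,
      smul_eq_mul, star_mul] at h1
    by_contra h0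
    refine hne (mul_right_cancel₀ h0 ?_)
    linear_combination h1 - (star (χ l (α ab.1) * χ l (β ab.2)) *
      (χ l (α ab'.1) * χ l (β ab'.2))) * (star (col ab) ⬝ᵥ col ab') * hc
  have hiso : Wᴴ * W = 1 := by
    ext ab ab'
    have h1 : (Wᴴ * W) ab ab' = star (col ab) ⬝ᵥ col ab' := rfl
    rw [h1, Matrix.one_apply]
    split_ifs with heq
    · subst heq
      simp only [col]
      rw [hE.dotProduct_mulVec, hE.dotProduct_mulVec, hψ1]
    · by_cases ha : ab.1 = ab'.1
      · have hb : ab.2 ≠ ab'.2 := fun hb => heq (Prod.ext ha hb)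
        -- By maximality of `B`, a difference in `P` outside `B` fails to be orthogonal to some `l`
        -- in `B`, and `E l` separates the two states.
        have h2 : β ab.2 - β ab'.2 ∉ B := fun h => hb (hβinj _ _ h)
        rw [hB] at h2
        have h3 : ¬ ∀ l ∈ B, χ (β ab.2 - β ab'.2) l = 1 := fun h =>
          h2 ⟨h, P.sub_mem (hβP _) (hβP _)⟩
        push Not at h3
        obtain ⟨l, hl, hne⟩ := h3
        obtain ⟨c, hc, hcψ⟩ := hψB l hl
        refine horth l c hc hcψ ab ab' fun h4 => hne ?_
        rw [hcross l (hBP hl) _ (hαQ _), hcross l (hBP hl) _ (hαQ _), one_mul, one_mul] at h4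
        rw [hχ.swap_eq_one, sub_eq_add_neg, AddChar.map_add_eq_mul, AddChar.map_neg_eq_conj]
        have h5 := congrArg star h4
        rwa [star_mul, star_star, star_one, mul_comm] at h5
      · have h2 : α ab.1 - α ab'.1 ∉ A := fun h => ha (hαinj _ _ h)
        rw [hA] at h2
        have h3 : ¬ ∀ l ∈ A, χ (α ab.1 - α ab'.1) l = 1 := fun h =>
          h2 ⟨h, Q.sub_mem (hαQ _) (hαQ _)⟩
        push Not at h3
        obtain ⟨l, hl, hne⟩ := h3
        obtain ⟨c, hc, hcψ⟩ := hψA l hl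
        refine horth l c hc hcψ ab ab' fun h4 => hne ?_
        rw [hcross' _ (hβP _) l (hAQ hl), hcross' _ (hβP _) l (hAQ hl), mul_one, mul_one] at h4
        rw [hχ.swap_eq_one, sub_eq_add_neg, AddChar.map_add_eq_mul, AddChar.map_neg_eq_conj]
        have h5 := congrArg star h4
        rwa [star_mul, star_star, star_one, mul_comm] at h5
  have hPW : ∀ v ∈ P, ∃ X : Matrix (Fin R) (Fin R) ℂ,
      E v * W = W * ((1 : Matrix (Fin K) (Fin K) ℂ) ⊗ₖ X) := by
    intro v hv
    choose f μ hf using fun b => hE.exists_mulVec_representative (L := B)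
      (fun w hw => (hψB w hw).imp fun _ h => h.2) hβP hβ hv b
    refine ⟨Matrix.of fun b' b => if b' = f b then μ b else 0, ?_⟩
    ext i ⟨a, b⟩
    have h1 : E v *ᵥ col (a, b) = μ b • col (a, f b) := by
      simp only [col]
      rw [hE.mulVec_comm, hcross v hv _ (hαQ _), one_smul, hf, Matrix.mulVec_smul]
    rw [hmulW, h1, Matrix.mul_apply, Fintype.sum_prod_type]
    simp [Matrix.one_apply, W, mul_comm]
  have hQW : ∀ v ∈ Q, ∃ Y : Matrix (Fin K) (Fin K) ℂ,
      E v * W = W * (Y ⊗ₖ (1 : Matrix (Fin R) (Fin R) ℂ)) := by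
    intro v hv
    choose f μ hf using fun a => hE.exists_mulVec_representative (L := A)
      (fun w hw => (hψA w hw).imp fun _ h => h.2) hαQ hα hv a
    refine ⟨Matrix.of fun a' a => if a' = f a then μ a else 0, ?_⟩
    ext i ⟨a, b⟩
    have h0 : ∀ a b, col (a, b) = E (β b) *ᵥ (E (α a) *ᵥ ψ) := fun a b => by
      simp only [col]
      rw [hE.mulVec_comm, hcross' _ (hβP _) _ (hαQ _), one_smul]
    have h1 : E v *ᵥ col (a, b) = μ a • col (f a, b) := by
      rw [h0, h0, hE.mulVec_comm, hcross' _ (hβP _) v hv, one_smul, hf, Matrix.mulVec_smul]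
    rw [hmulW, h1, Matrix.mul_apply, Fintype.sum_prod_type]
    simp [Matrix.one_apply, W, mul_comm]
  refine ⟨W, hiso, fun v => ⟨fun ⟨X, hX⟩ hv => ?_, fun hv => ?_⟩⟩
  -- The perp of `P ⊓ Q` is `P ⊔ Q`, so `E v` preserves the code space. If it acts there as `1 ⊗ X`,
  -- it commutes there with every `E z`, `z ∈ Q`; since `W ≠ 0` this forces `χ v z = 1`, so `v ∈ P`.
  · by_contra hvP
    have hsup : hχ.perp (P ⊓ Q) = P ⊔ Q := by
      have h1 := hχ.perp_sup Q P
      rw [hPQ, hQP] at h1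
      rw [← h1, hχ.perp_perp, sup_comm]
    rw [hsup] at hv
    obtain ⟨u, hu, w, hw, rfl⟩ := AddSubgroup.mem_sup.1 hv
    obtain ⟨X₁, hX₁⟩ := hPW u hu
    obtain ⟨Y₁, hY₁⟩ := hQW w hw
    obtain ⟨c, hc0, hc⟩ := hE.mul u w
    have hEv : E (u + w) = c⁻¹ • (E u * E w) := by
      rw [hc, smul_smul, inv_mul_cancel₀ hc0, one_smul]
    have hrange : ∃ M : Matrix (Fin K × Fin R) (Fin K × Fin R) ℂ, E (u + w) * W = W * M := by
      refine ⟨c⁻¹ • (((1 : Matrix (Fin K) (Fin K) ℂ) ⊗ₖ X₁) * (Y₁ ⊗ₖ (1 : Matrix (Fin R) (Fin R) ℂ))),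
        ?_⟩
      rw [hEv, Matrix.smul_mul, Matrix.mul_assoc, hY₁, ← Matrix.mul_assoc, hX₁, Matrix.mul_assoc,
        Matrix.mul_smul]
    obtain ⟨M, hM⟩ := hrange
    have hMX : M = (1 : Matrix (Fin K) (Fin K) ℂ) ⊗ₖ X := by
      rw [← hX, Matrix.mul_assoc, hM, ← Matrix.mul_assoc, hiso, Matrix.one_mul]
    rw [hMX] at hM
    have h1 : ¬ ∀ z ∈ Q, χ (u + w) z = 1 := fun h => hvP (by rw [← hQP]; exact h)
    push Not at h1
    obtain ⟨z, hz, hne⟩ := h1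
    obtain ⟨Y, hY⟩ := hQW z hz
    have h2 : E (u + w) * E z * W = E z * E (u + w) * W := by
      rw [Matrix.mul_assoc, hY, ← Matrix.mul_assoc, hM, Matrix.mul_assoc (E z), hM,
        ← Matrix.mul_assoc, hY, Matrix.mul_assoc, Matrix.mul_assoc, ← Matrix.mul_kronecker_mul,
        ← Matrix.mul_kronecker_mul]
      simp
    have h3 : (1 - χ (u + w) z) • (E z * E (u + w) * W) = 0 := by
      rw [sub_smul, one_smul, ← Matrix.smul_mul, ← hE.comm, h2, sub_self]
    have h4 : E z * E (u + w) * W = 0 :=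
      (smul_eq_zero.1 h3).resolve_left (sub_ne_zero.2 hne.symm)
    have h5 : W = 0 := by
      calc W = (E (u + w))ᴴ * ((E z)ᴴ * (E z * E (u + w) * W)) := by
            rw [Matrix.mul_assoc (E z), ← Matrix.mul_assoc (E z)ᴴ, hE.unitary, Matrix.one_mul,
              ← Matrix.mul_assoc, hE.unitary, Matrix.one_mul]
        _ = 0 := by rw [h4, Matrix.mul_zero, Matrix.mul_zero]
    rw [h5, Matrix.mul_zero] at hiso
    have h6 := congrFun (congrFun hiso (⟨0, hK0⟩, ⟨0, hR0⟩)) (⟨0, hK0⟩, ⟨0, hR0⟩)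
    simp at h6
  · by_cases hvS : v ∈ hχ.perp (P ⊓ Q)
    · obtain ⟨X, hX⟩ := hPW v (hv hvS)
      exact ⟨X, by rw [Matrix.mul_assoc, hX, ← Matrix.mul_assoc, hiso, Matrix.one_mul]⟩
    -- Some `s ∈ P ⊓ Q` acts as a scalar on the code but does not commute with `E v`. The
    -- compression of `E v` then equals a multiple of itself by a factor other than one, so it is
    -- zero.
    · have h1 : ¬ ∀ s ∈ P ⊓ Q, χ v s = 1 := hvS
      push Not at h1
      obtain ⟨s, hs, hne⟩ := h1
      have hsA : s ∈ A := by
        rw [hA]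
        exact ⟨fun l hl => hcross s hs.1 l (hAQ hl), hs.2⟩
      obtain ⟨c, hc, hcψ⟩ := hψA s hsA
      have hsW : E s * W = c • W := by
        ext i ab
        rw [hmulW, hcol s c hcψ, hcross s hs.1 _ (hαQ _), hcross' _ (hβP _) s hs.2, one_mul,
          one_mul]
        rfl
      have h2 : Wᴴ * E v * W = χ s v • (Wᴴ * E v * W) := by
        calc Wᴴ * E v * W = Wᴴ * ((E s)ᴴ * E s) * E v * W := by
              rw [hE.unitary, Matrix.mul_one]
          _ = (E s * W)ᴴ * (E s * E v) * W := by
              rw [Matrix.conjTranspose_mul]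
              simp only [Matrix.mul_assoc]
          _ = χ s v • ((E s * W)ᴴ * E v * (E s * W)) := by
              rw [hE.comm, Matrix.mul_smul, Matrix.smul_mul]
              simp only [Matrix.mul_assoc]
          _ = χ s v • (Wᴴ * E v * W) := by
              rw [hsW, Matrix.conjTranspose_smul, Matrix.smul_mul, Matrix.smul_mul, Matrix.mul_smul,
                smul_smul (star c), hc, one_smul]
      have h3 : (1 - χ s v) • (Wᴴ * E v * W) = 0 := by
        rw [sub_smul, one_smul, ← h2, sub_self]
      refine ⟨0, ?_⟩
      rw [Matrix.kronecker_zero]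
      refine (smul_eq_zero.1 h3).resolve_left fun h4 => hne ?_
      exact hχ.swap_eq_one.1 (sub_eq_zero.1 h4).symm

end IsWeylSystem

end WeylSystem

/-! ### The fixed field of the conjugation -/

section FixedField

variable {F : Type*} [Field F] [Fintype F] {q : ℕ} {σ : F →+* F}

/-- The subfield of elements fixed by `σ`. -/
abbrev fixedSubfield (σ : F →+* F) : Subfield F := RingHom.eqLocusField σ (RingHom.id F)

/-- The additive map `σ - id` has its kernel among the roots of `X ^ q - X` and its range among
those of `X ^ q + X`. Both have at most `q` elements and their orders multiply to `q ^ 2`. -/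
theorem card_fixedSubfield (hσ : ∀ x, σ x = x ^ q) (hσσ : ∀ x, σ (σ x) = x)
    (hF : Fintype.card F = q ^ 2) : Nat.card (fixedSubfield σ) = q := by
  classical
  have hq : 1 < q := by
    have h1 := Fintype.one_lt_card (α := F)
    rw [hF] at h1
    by_contra h
    interval_cases q <;> simp at h1
  let d : F →+ F := σ.toAddMonoidHom - AddMonoidHom.id F
  have hd : ∀ x, d x = σ x - x := fun x => rfl
  have hroots : ∀ (A : AddSubgroup F) (p : Polynomial F), p.natDegree = q → p ≠ 0 →
      (∀ x ∈ A, p.IsRoot x) → Nat.card A ≤ q := by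
    intro A p hp hp0 hA
    have h1 : (A : Set F).ncard ≤ (p.roots.toFinset : Set F).ncard :=
      Set.ncard_le_ncard fun x hx => by simpa [hp0] using hA x hx
    rw [Set.ncard_coe_finset] at h1
    calc Nat.card A = (A : Set F).ncard := rfl
      _ ≤ _ := h1
      _ ≤ p.roots.card := Multiset.toFinset_card_le _
      _ ≤ q := hp ▸ p.card_roots'
  have hker : Nat.card d.ker ≤ q := by
    refine hroots _ (Polynomial.X ^ q - Polynomial.X) ?_ ?_ fun x hx => ?_
    · exact FiniteField.X_pow_card_sub_X_natDegree_eq F hq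
    · exact FiniteField.X_pow_card_sub_X_ne_zero F hq
    · have h1 : σ x - x = 0 := hx
      simpa [hσ] using h1
  have hdeg : (Polynomial.X ^ q + Polynomial.X : Polynomial F).natDegree = q := by
    rw [Polynomial.natDegree_add_eq_left_of_natDegree_lt] <;> simp [hq]
  have hrange : Nat.card d.range ≤ q := by
    refine hroots _ (Polynomial.X ^ q + Polynomial.X) hdeg ?_ ?_
    · rintro h0
      rw [h0] at hdeg
      simp at hdeg
      omega
    · rintro _ ⟨x, rfl⟩
      simp [hd, ← hσ, hσσ]
  have hmul : Nat.card d.ker * Nat.card d.range = q ^ 2 := by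
    have h1 := AddSubgroup.card_mul_index d.ker
    rw [AddSubgroup.index_ker] at h1
    rw [h1, Nat.card_eq_fintype_card, hF]
  have h1 : Nat.card (fixedSubfield σ) = Nat.card d.ker := by
    refine Nat.card_congr (Equiv.subtypeEquivRight fun x => ?_)
    rw [AddMonoidHom.mem_ker, hd, sub_eq_zero]
    rfl
  rw [h1]
  nlinarith

theorem exists_notMem_fixedSubfield (hσ : ∀ x, σ x = x ^ q) (hσσ : ∀ x, σ (σ x) = x)
    (hF : Fintype.card F = q ^ 2) : ∃ β : F, β ∉ fixedSubfield σ := by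
  by_contra! h
  have h1 := card_fixedSubfield hσ hσσ hF
  have h2 : Nat.card (fixedSubfield σ) = Nat.card F :=
    Nat.card_congr (Equiv.subtypeUnivEquiv h)
  rw [h1, Nat.card_eq_fintype_card, hF] at h2
  have h3 := Fintype.one_lt_card (α := F)
  rw [hF] at h3
  nlinarith

/-- A nontrivial additive character that is trivial on the fixed field. -/
theorem exists_addChar_trivial_on_fixedSubfield {β : F} (hβ : β ∉ fixedSubfield σ) :
    ∃ θ : AddChar F ℂ, (∀ x ∈ fixedSubfield σ, θ x = 1) ∧ θ β ≠ 1 := by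
  obtain ⟨ψ, hψ⟩ := AddChar.exists_apply_ne_zero.2
    (show (QuotientAddGroup.mk β : F ⧸ (fixedSubfield σ).toAddSubgroup) ≠ 0 from fun h =>
      hβ ((QuotientAddGroup.eq_zero_iff β).1 h))
  refine ⟨ψ.compAddMonoidHom (QuotientAddGroup.mk' _), fun x hx => ?_, hψ⟩
  have h1 : (QuotientAddGroup.mk x : F ⧸ (fixedSubfield σ).toAddSubgroup) = 0 :=
    (QuotientAddGroup.eq_zero_iff x).2 hx
  change ψ (QuotientAddGroup.mk x) = 1
  rw [h1, AddChar.map_zero_eq_one]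

/-- The coordinates with respect to the basis `1, β` over the fixed field. -/
theorem exists_coordinates (hσ : ∀ x, σ x = x ^ q) (hσσ : ∀ x, σ (σ x) = x)
    (hF : Fintype.card F = q ^ 2) {β : F} (hβ : β ∉ fixedSubfield σ) :
    ∃ e : (fixedSubfield σ × fixedSubfield σ) ≃+ F, ∀ x z, e (x, z) = x + β * z := by
  let f : (fixedSubfield σ × fixedSubfield σ) →+ F :=
    { toFun := fun a => a.1 + β * a.2
      map_zero' := by simp
      map_add' := fun a b => by simp; ring }
  have hf : Function.Injective f := by
    refine (injective_iff_map_eq_zero f).2 ?_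
    rintro ⟨x, z⟩ h
    have h0 : (x : F) + β * z = 0 := h
    by_cases hz : z = 0
    · subst hz
      simpa using h0
    · refine absurd ?_ hβ
      have hz' : (z : F) ≠ 0 := fun h => hz (Subtype.ext h)
      have h1 : β = ((-x / z : fixedSubfield σ) : F) := by
        push_cast
        rw [eq_div_iff hz']
        linear_combination h0
      rw [h1]
      exact Subtype.coe_prop _
  have hcard : Nat.card (fixedSubfield σ × fixedSubfield σ) = Nat.card F := by
    rw [Nat.card_prod, card_fixedSubfield hσ hσσ hF, Nat.card_eq_fintype_card, hF, sq]
  exact ⟨AddEquiv.ofBijective f ((Nat.bijective_iff_injective_and_card f).2 ⟨hf, hcard⟩),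
    fun x z => rfl⟩

end FixedField

/-! ### From the Hermitian form to a symplectic character -/

section HermitianCharacter

variable {F : Type*} [Field F] {σ : F →+* F} {n : ℕ}

/-- The bicharacter obtained from the Hermitian inner product and an additive character. -/
def hermChar (σ : F →+* F) (θ : AddChar F ℂ) (u : Fin n → F) : AddChar (Fin n → F) ℂ where
  toFun v := θ (∑ i, u i * σ (v i))
  map_zero_eq_one' := by simp
  map_add_eq_mul' v w := by
    simp [mul_add, Finset.sum_add_distrib, AddChar.map_add_eq_mul]

theorem hermChar_apply {θ : AddChar F ℂ} (u v : Fin n → F) :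
    hermChar σ θ u v = θ (∑ i, u i * σ (v i)) := rfl

/-- The form takes values fixed by `σ` on the diagonal, where `θ` is trivial; this is what makes the
bicharacter alternating. -/
theorem isSymplecticChar_hermChar (hσσ : ∀ x, σ (σ x) = x) {θ : AddChar F ℂ}
    (hθ : ∀ x ∈ fixedSubfield σ, θ x = 1) {β : F} (hβ : θ β ≠ 1) :
    IsSymplecticChar (hermChar (n := n) σ θ) where
  add_left u v w := by
    simp [hermChar_apply, add_mul, Finset.sum_add_distrib, AddChar.map_add_eq_mul]
  self u := by
    refine hθ _ ?_
    change σ _ = _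
    simp [hσσ, mul_comm]
  nondeg u hu := by
    ext i
    by_contra h0
    have h1 : u i ≠ 0 := h0
    refine hβ ?_
    have h2 := hu (Pi.single i (σ (β / u i)))
    rw [hermChar_apply, Finset.sum_eq_single i] at h2
    · rwa [Pi.single_eq_same, hσσ, mul_div_cancel₀ _ h1] at h2
    · intro j _ hj
      rw [Pi.single_eq_of_ne hj, map_zero, mul_zero]
    · simp

/-- Passing to `θ` loses nothing on a linear code: if the form is nonzero at `v`, some scalar
multiple of `v` gives it the value `β`, where `θ` is nontrivial. -/
theorem perp_toAddSubgroup {q : ℕ} (hσ : ∀ x, σ x = x ^ q) (hσσ : ∀ x, σ (σ x) = x)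
    {θ : AddChar F ℂ} {β : F} (hβ : θ β ≠ 1) (hχ : IsSymplecticChar (hermChar (n := n) σ θ))
    (C : Submodule F (Fin n → F)) :
    hχ.perp C.toAddSubgroup = (hermDual q C).toAddSubgroup := by
  ext u
  have h1 : ∀ v, hermChar σ θ u v = θ (hermInner q u v) := fun v => by
    simp [hermChar_apply, hermInner, hσ]
  change (∀ v ∈ C, hermChar σ θ u v = 1) ↔ ∀ v ∈ C, hermInner q u v = 0
  refine ⟨fun h v hv => ?_, fun h v hv => by rw [h1, h v hv, AddChar.map_zero_eq_one]⟩
  by_contra h0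
  refine hβ ?_
  have h2 := h _ (C.smul_mem (σ (β / hermInner q u v)) hv)
  have h3 : hermInner q u (σ (β / hermInner q u v) • v) = β := by
    have h4 : hermInner q u (σ (β / hermInner q u v) • v) =
        β / hermInner q u v * hermInner q u v := by
      nth_rewrite 1 [hermInner]
      nth_rewrite 3 [hermInner]
      rw [Finset.mul_sum]
      refine Finset.sum_congr rfl fun i _ => ?_
      rw [Pi.smul_apply, smul_eq_mul, mul_pow, ← hσ, hσσ]
      ring
    rw [h4, div_mul_cancel₀ _ h0]
  rwa [h1, h3] at h2

end HermitianCharacter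

/-! ### Generalized Pauli matrices as an error basis -/

section ErrorBasis

variable {F : Type*} [Field F] {σ : F →+* F} {n q : ℕ}

/-- The shift of the standard basis vectors by `v`, with the positions labelled by `e`. -/
def weylShift (e : Fin q ≃ fixedSubfield σ) (c : (fixedSubfield σ × fixedSubfield σ) ≃+ F)
    (v : Fin n → F) (y : Fin n → Fin q) : Fin n → Fin q :=
  fun i => e.symm (e (y i) + (c.symm (v i)).1)

/-- The phase exponent of `v` at a standard basis vector. -/
def weylPhase (e : Fin q ≃ fixedSubfield σ) (c : (fixedSubfield σ × fixedSubfield σ) ≃+ F)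
    (β : F) (v : Fin n → F) (y : Fin n → Fin q) : F :=
  ∑ i, β * (c.symm (v i)).2 * e (y i)

/-- The generalized Pauli matrix `X(x) Z(z)` for `v = x + β z`. -/
def weylMatrix (e : Fin q ≃ fixedSubfield σ) (c : (fixedSubfield σ × fixedSubfield σ) ≃+ F)
    (β : F) (θ : AddChar F ℂ) (v : Fin n → F) : Matrix (Fin n → Fin q) (Fin n → Fin q) ℂ :=
  Matrix.of fun y y' => if y = weylShift e c v y' then θ (weylPhase e c β v y') else 0

variable {e : Fin q ≃ fixedSubfield σ} {c : (fixedSubfield σ × fixedSubfield σ) ≃+ F}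
  {β : F} {θ : AddChar F ℂ}

theorem weylShift_add (u v : Fin n → F) (y : Fin n → Fin q) :
    weylShift e c (u + v) y = weylShift e c u (weylShift e c v y) := by
  ext i
  simp [weylShift, add_assoc, add_comm]

theorem weylShift_injective (v : Fin n → F) : Function.Injective (weylShift e c v) := by
  intro y y' h
  ext i
  have h1 := congrFun h i
  simp only [weylShift, EmbeddingLike.apply_eq_iff_eq, add_left_inj] at h1
  rw [h1]

theorem weylPhase_add (u v : Fin n → F) (y : Fin n → Fin q) :
    weylPhase e c β (u + v) y = weylPhase e c β u y + weylPhase e c β v y := by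
  simp [weylPhase, mul_add, add_mul, Finset.sum_add_distrib]

theorem weylPhase_weylShift (u v : Fin n → F) (y : Fin n → Fin q) :
    weylPhase e c β u (weylShift e c v y) =
      weylPhase e c β u y + ∑ i, β * (c.symm (u i)).2 * (c.symm (v i)).1 := by
  simp [weylPhase, weylShift, mul_add, Finset.sum_add_distrib]

theorem weylMatrix_mul (u v : Fin n → F) :
    weylMatrix e c β θ u * weylMatrix e c β θ v =
      θ (∑ i, β * (c.symm (u i)).2 * (c.symm (v i)).1) • weylMatrix e c β θ (u + v) := by
  ext y y'
  rw [Matrix.mul_apply, Finset.sum_eq_single (weylShift e c v y')]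
  · simp only [weylMatrix, Matrix.of_apply, Matrix.smul_apply, if_true, weylShift_add,
      weylPhase_weylShift, weylPhase_add, AddChar.map_add_eq_mul, smul_eq_mul, mul_ite, ite_mul,
      mul_zero, zero_mul]
    split_ifs <;> ring
  · intro w _ hw
    simp [weylMatrix, hw]
  · simp

theorem isWeylSystem_weylMatrix [Finite F] (hσσ : ∀ x, σ (σ x) = x)
    (hc : ∀ x z, c (x, z) = x + β * z) (hθ : ∀ x ∈ fixedSubfield σ, θ x = 1) :
    IsWeylSystem (hermChar (n := n) σ θ) (weylMatrix (n := n) e c β θ) where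
  unitary v := by
    ext y y'
    rw [Matrix.mul_apply, Finset.sum_eq_single (weylShift e c v y')]
    · simp only [weylMatrix, Matrix.conjTranspose_apply, Matrix.of_apply, if_true,
        (weylShift_injective v).eq_iff, Matrix.one_apply]
      by_cases h : y = y'
      · subst h
        rw [if_pos rfl, if_pos rfl, Complex.star_def, ← AddChar.map_neg_eq_conj,
          ← AddChar.map_add_eq_mul, neg_add_cancel, AddChar.map_zero_eq_one]
      · rw [if_neg (Ne.symm h), if_neg h, star_zero, zero_mul]
    · intro w _ hw
      simp [weylMatrix, hw]
    · simp
  mul u v := by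
    refine ⟨_, fun h0 => ?_, weylMatrix_mul u v⟩
    have h1 := AddChar.map_add_eq_mul θ (∑ i, β * (c.symm (u i)).2 * (c.symm (v i)).1)
      (-∑ i, β * (c.symm (u i)).2 * (c.symm (v i)).1)
    rw [h0, add_neg_cancel, AddChar.map_zero_eq_one, zero_mul] at h1
    exact one_ne_zero h1
  comm u v := by
    rw [weylMatrix_mul, weylMatrix_mul, add_comm v u, smul_smul]
    congr 1
    rw [hermChar_apply, ← AddChar.map_add_eq_mul]
    have hsplit : ∀ a, a = ((c.symm a).1 : F) + β * (c.symm a).2 := fun a => by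
      rw [← hc]; simp
    have hfix : ∀ x : fixedSubfield σ, σ x = x := fun x => x.2
    -- Expanding the Hermitian form in the coordinates `x + β z` gives the difference of the two
    -- phase exponents plus terms fixed by `σ`, namely norms, traces and elements of the fixed
    -- field; `θ` ignores these.
    have h1 : ∑ i, β * ((c.symm (u i)).2 : F) * (c.symm (v i)).1 +
        ∑ i, (((c.symm (u i)).1 : F) * (c.symm (v i)).1 +
          β * σ β * (c.symm (u i)).2 * (c.symm (v i)).2 +
          (β + σ β) * (c.symm (v i)).2 * (c.symm (u i)).1) =
        ∑ i, u i * σ (v i) + ∑ i, β * ((c.symm (v i)).2 : F) * (c.symm (u i)).1 := by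
      rw [← Finset.sum_add_distrib, ← Finset.sum_add_distrib]
      refine Finset.sum_congr rfl fun i _ => ?_
      have hv : σ (v i) = (c.symm (v i)).1 + σ β * (c.symm (v i)).2 := by
        conv_lhs => rw [hsplit (v i), map_add, map_mul, hfix, hfix]
      rw [hv]
      linear_combination
        (((c.symm (v i)).1 : F) + σ β * (c.symm (v i)).2) * -hsplit (u i)
    rw [← h1, AddChar.map_add_eq_mul]
    refine (mul_one _).symm.trans (congrArg _ (hθ _ ?_).symm)
    change σ _ = _
    simp only [map_sum, map_add, map_mul, hfix, hσσ, RingHom.id_apply]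
    refine Finset.sum_congr rfl fun i _ => ?_
    ring

theorem coordinates_zero : c.symm 0 = (0, 0) := by
  rw [map_zero]; rfl

/-- A generalized Pauli matrix acts on the support of its label. -/
theorem actsOn_weylMatrix {T : Finset (Fin n)} {v : Fin n → F} (hv : ∀ i ∉ T, v i = 0) :
    ActsOn T (weylMatrix e c β θ v) := by
  classical
  refine ⟨Matrix.of fun a b => if ∀ i : T, a i = e.symm (e (b i) + (c.symm (v i)).1) then
    θ (∑ i : T, β * (c.symm (v i)).2 * e (b i)) else 0, fun x y => ⟨fun h => ?_, ?_⟩⟩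
  · have h1 : weylPhase e c β v y = ∑ i : T, β * (c.symm (v i)).2 * e (y i) := by
      rw [weylPhase, Finset.sum_coe_sort T fun i => β * ((c.symm (v i)).2 : F) * e (y i)]
      refine (Finset.sum_subset (Finset.subset_univ T) fun i _ hi => ?_).symm
      simp [hv i hi, coordinates_zero]
    have h2 : x = weylShift e c v y ↔
        ∀ i : T, x i = e.symm (e (y i) + (c.symm (v i)).1) := by
      refine ⟨fun hx i => congrFun hx i, fun hx => funext fun i => ?_⟩
      by_cases hi : i ∈ T
      · exact hx ⟨i, hi⟩
      · simp [weylShift, hv i hi, h i hi]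
    simp only [weylMatrix, Matrix.of_apply, h1, h2]
  · rintro ⟨i, hi, hne⟩
    rw [weylMatrix, Matrix.of_apply, if_neg]
    rintro rfl
    exact hne (by simp [weylShift, hv i hi])

/-- Orthogonality of the characters of the positions in `T`. -/
theorem sum_addChar_pairing [Finite F] (hc : ∀ x z, c (x, z) = x + β * z)
    (hθ : ∀ x ∈ fixedSubfield σ, θ x = 1) {γ : F} (hγ : θ γ ≠ 1) {ι : Type*} [Fintype ι]
    [Fintype (ι → fixedSubfield σ)] [DecidableEq (ι → fixedSubfield σ)]
    (w : ι → fixedSubfield σ) :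
    ∑ z : ι → fixedSubfield σ, θ (∑ i, β * z i * w i) =
      if w = 0 then (Fintype.card (ι → fixedSubfield σ) : ℂ) else 0 := by
  classical
  let Ψ : AddChar (ι → fixedSubfield σ) ℂ :=
    { toFun := fun z => θ (∑ i, β * z i * w i)
      map_zero_eq_one' := by simp
      map_add_eq_mul' := fun a b => by
        simp [mul_add, add_mul, Finset.sum_add_distrib, AddChar.map_add_eq_mul] }
  have h1 := AddChar.sum_eq_ite Ψ
  have h2 : Ψ = 0 ↔ w = 0 := by
    rw [DFunLike.ext_iff]
    constructor
    · intro h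
      by_contra hw
      obtain ⟨i, hi⟩ := Function.ne_iff.1 hw
      have hi' : (w i : F) ≠ 0 := fun h => hi (Subtype.ext h)
      refine hγ ?_
      -- With `γ = x + β z` and `θ` trivial at `x`, the character is nontrivial already at `β z`;
      -- dividing by `w i` makes the pairing hit this value.
      obtain ⟨⟨x, z⟩, rfl⟩ := c.surjective γ
      rw [hc, AddChar.map_add_eq_mul, hθ x x.2, one_mul]
      have h3 : θ (∑ j, β * (Pi.single i (z / w i) : ι → fixedSubfield σ) j * w j) = 1 :=
        h (Pi.single i (z / w i))
      rw [Finset.sum_eq_single i] at h3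
      · rw [Pi.single_eq_same] at h3
        push_cast at h3
        rwa [mul_assoc, div_mul_cancel₀ _ hi'] at h3
      · intro j _ hj
        rw [Pi.single_eq_of_ne hj]
        simp
      · simp
    · rintro rfl z
      simp [Ψ]
  simpa [h2, Ψ] using h1

/-- The operators on the positions in `T` are spanned by the generalized Pauli matrices with
support in `T`. -/
theorem ActsOn.mem_span_weylMatrix [Finite F] (hc : ∀ x z, c (x, z) = x + β * z)
    (hθ : ∀ x ∈ fixedSubfield σ, θ x = 1) {γ : F} (hγ : θ γ ≠ 1) {T : Finset (Fin n)}
    {E : Matrix (Fin n → Fin q) (Fin n → Fin q) ℂ} (hE : ActsOn T E) :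
    E ∈ Submodule.span ℂ (weylMatrix e c β θ '' {v | ∀ i ∉ T, v i = 0}) := by
  classical
  have := Fintype.ofFinite F
  obtain ⟨f, hf⟩ := hE
  let lab : (T → Fin q) → (T → Fin q) → (T → fixedSubfield σ) → Fin n → F := fun a b z i =>
    if h : i ∈ T then c (e (a ⟨i, h⟩) - e (b ⟨i, h⟩), z ⟨i, h⟩) else 0
  -- Fourier inversion: the shift by `a - b` is fixed, and averaging over `z` against the inverse
  -- phase at `b` leaves only the column `b`, hence the matrix unit at `(a, b)`.
  have key : E = ∑ a : T → Fin q, ∑ b : T → Fin q, ∑ z : T → fixedSubfield σ,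
      (f a b * (Fintype.card (T → fixedSubfield σ) : ℂ)⁻¹ * θ (-∑ i : T, β * z i * e (b i))) •
        weylMatrix e c β θ (lab a b z) := by
    have hN : (Fintype.card (T → fixedSubfield σ) : ℂ) ≠ 0 := by
      exact_mod_cast Fintype.card_ne_zero
    ext x y
    have hshift : ∀ a b z, x = weylShift e c (lab a b z) y ↔
        (∀ i, i ∉ T → x i = y i) ∧ ∀ i : T, e (x i) = e (y i) + (e (a i) - e (b i)) := by
      intro a b z
      constructor
      · rintro rfl
        exact ⟨fun i hi => by simp [weylShift, lab, hi], fun i => by simp [weylShift, lab]⟩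
      · rintro ⟨h1, h2⟩
        ext i
        by_cases hi : i ∈ T
        · have := h2 ⟨i, hi⟩
          simp [weylShift, lab, hi, ← this]
        · simp [weylShift, lab, hi, h1 i hi]
    have hphase : ∀ a b z, weylPhase e c β (lab a b z) y = ∑ i : T, β * z i * e (y i) := by
      intro a b z
      have h1 : weylPhase e c β (lab a b z) y = ∑ i ∈ T, β * (c.symm (lab a b z i)).2 * e (y i) :=
        (Finset.sum_subset (Finset.subset_univ T) fun i _ hi => by simp [lab, hi]).symm
      rw [h1, ← Finset.sum_coe_sort]
      exact Finset.sum_congr rfl fun i _ => by simp [lab]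
    have hterm : ∀ a b, (∑ z : T → fixedSubfield σ,
        (f a b * (Fintype.card (T → fixedSubfield σ) : ℂ)⁻¹ * θ (-∑ i : T, β * z i * e (b i))) •
          weylMatrix e c β θ (lab a b z)) x y =
        if (∀ i, i ∉ T → x i = y i) ∧ (fun i : T => x i) = a ∧ (fun i : T => y i) = b
          then f a b else 0 := by
      intro a b
      rw [Matrix.sum_apply]
      have h1 : ∀ z : T → fixedSubfield σ,
          ((f a b * (Fintype.card (T → fixedSubfield σ) : ℂ)⁻¹ *
            θ (-∑ i : T, β * z i * e (b i))) • weylMatrix e c β θ (lab a b z)) x y =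
          (if (∀ i, i ∉ T → x i = y i) ∧ ∀ i : T, e (x i) = e (y i) + (e (a i) - e (b i)) then
            f a b * (Fintype.card (T → fixedSubfield σ) : ℂ)⁻¹ else 0) *
            θ (∑ i : T, β * z i * ((e (y i) - e (b i) : fixedSubfield σ) : F)) := by
        intro z
        have h2 : (∑ i : T, β * z i * ((e (y i) - e (b i) : fixedSubfield σ) : F)) =
            -(∑ i : T, β * z i * (e (b i) : F)) + ∑ i : T, β * z i * (e (y i) : F) := by
          rw [← Finset.sum_neg_distrib, ← Finset.sum_add_distrib]
          refine Finset.sum_congr rfl fun i _ => ?_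
          push_cast
          ring
        rw [Matrix.smul_apply, weylMatrix, Matrix.of_apply, hphase, h2, AddChar.map_add_eq_mul,
          smul_eq_mul]
        simp only [hshift]
        split_ifs <;> ring
      rw [Finset.sum_congr rfl fun z _ => h1 z, ← Finset.mul_sum,
        sum_addChar_pairing hc hθ hγ fun i : T => e (y i) - e (b i)]
      by_cases hb : (fun i : T => y i) = b
      · have h3 : (fun i : T => e (y i) - e (b i)) = 0 := by
          ext i; simp [← hb]
        have h4 : (∀ i : T, e (x i) = e (y i) + (e (a i) - e (b i))) ↔
            (fun i : T => x i) = a := by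
          rw [funext_iff]
          refine forall_congr' fun i => ?_
          rw [← hb, add_sub_cancel, e.apply_eq_iff_eq]
        rw [if_pos h3]
        simp only [h4, hb, and_true]
        split_ifs
        · field_simp
        · simp
      · have h3 : (fun i : T => e (y i) - e (b i)) ≠ 0 := by
          intro h
          refine hb (funext fun i => ?_)
          have h5 := congrFun h i
          simpa [sub_eq_zero] using h5
        rw [if_neg h3, mul_zero, if_neg fun h => hb h.2.2]
    have hsum : (∑ a : T → Fin q, ∑ b : T → Fin q, ∑ z : T → fixedSubfield σ,
        (f a b * (Fintype.card (T → fixedSubfield σ) : ℂ)⁻¹ * θ (-∑ i : T, β * z i * e (b i))) •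
          weylMatrix e c β θ (lab a b z)) x y = ∑ a : T → Fin q, ∑ b : T → Fin q,
        if (∀ i, i ∉ T → x i = y i) ∧ (fun i : T => x i) = a ∧ (fun i : T => y i) = b
          then f a b else 0 := by
      rw [Matrix.sum_apply]
      refine Finset.sum_congr rfl fun a _ => ?_
      rw [Matrix.sum_apply]
      exact Finset.sum_congr rfl fun b _ => hterm a b
    rw [hsum]
    by_cases hoff : ∀ i, i ∉ T → x i = y i
    · rw [(hf x y).1 hoff, Finset.sum_eq_single fun i : T => x i,
        Finset.sum_eq_single fun i : T => y i]
      · rw [if_pos ⟨hoff, rfl, rfl⟩]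
      · exact fun b _ hb => if_neg fun h => hb h.2.2.symm
      · simp
      · exact fun a _ ha => Finset.sum_eq_zero fun b _ => if_neg fun h => ha h.2.1.symm
      · simp
    · refine ((hf x y).2 (by push Not at hoff; exact hoff)).trans (Eq.symm ?_)
      exact Finset.sum_eq_zero fun a _ => Finset.sum_eq_zero fun b _ => if_neg fun h => hoff h.1
  rw [key]
  refine Submodule.sum_mem _ fun a _ => Submodule.sum_mem _ fun b _ => Submodule.sum_mem _
    fun z _ => Submodule.smul_mem _ _ (Submodule.subset_span ⟨_, fun i hi => ?_, rfl⟩)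
  simp [lab, hi]

end ErrorBasis

/-! ### The quantum code of a linear code, and the theorem -/

namespace SubsystemCode

variable {q n K R : ℕ}

/-- The operators detected by a subsystem code form a linear space. -/
def detected (Q : SubsystemCode q n K R) :
    Submodule ℂ (Matrix (Fin n → Fin q) (Fin n → Fin q) ℂ) where
  carrier := {E | Q.Detects E}
  zero_mem' := ⟨0, by simp⟩
  add_mem' := by
    rintro E E' ⟨X, hX⟩ ⟨X', hX'⟩
    exact ⟨X + X', by rw [Matrix.mul_add, Matrix.add_mul, hX, hX', Matrix.kronecker_add]⟩
  smul_mem' := by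
    rintro c E ⟨X, hX⟩
    exact ⟨c • X, by rw [Matrix.mul_smul, Matrix.smul_mul, hX, Matrix.kronecker_smul]⟩

end SubsystemCode

/-- The subsystem code obtained from a linear code over the field with `q ^ 2` elements. -/
theorem IsSubsystemParams.existsSubsystemCode {F : Type*} [Field F] [Fintype F] [DecidableEq F]
    {q : ℕ} (hq : IsPrimePow q) (hF : Fintype.card F = q ^ 2) {n κ r δ : ℕ}
    {C : Submodule F (Fin n → F)} (hC : IsSubsystemParams q C κ r δ) :
    ExistsSubsystemCode q n κ r δ := by
  obtain ⟨σ, hσ, hσσ⟩ := exists_ringHom_pow_involutive hq hF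
  obtain ⟨β, hβ⟩ := exists_notMem_fixedSubfield hσ hσσ hF
  obtain ⟨θ, hθ, hθβ⟩ := exists_addChar_trivial_on_fixedSubfield hβ
  obtain ⟨c, hc⟩ := exists_coordinates hσ hσσ hF hβ
  have hq0 : 0 < q := hq.pos
  let e : Fin q ≃ fixedSubfield σ :=
    (Finite.equivFinOfCardEq (card_fixedSubfield hσ hσσ hF)).symm
  have hχ := isSymplecticChar_hermChar (n := n) hσσ hθ hθβ
  have hE := isWeylSystem_weylMatrix (n := n) (e := e) hσσ hc hθ
  have hcard : ∀ W : Submodule F (Fin n → F),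
      Nat.card W.toAddSubgroup = (q ^ 2) ^ Module.finrank F W := fun W => by
    rw [← hF, ← Nat.card_eq_fintype_card (α := F)]
    exact Module.natCard_eq_pow_finrank (K := F) (V := W)
  have hperp := perp_toAddSubgroup hσ hσσ hθβ hχ
  have hinf : C.toAddSubgroup ⊓ (hermDual q C).toAddSubgroup = (hermHull q C).toAddSubgroup := rfl
  have hdual := hχ.card_perp_mul_card C.toAddSubgroup
  have hV : Nat.card (Fin n → F) = (q ^ 2) ^ κ * (q ^ 2) ^ Module.finrank F C *
      (q ^ 2) ^ Module.finrank F (hermHull q C) := by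
    rw [← pow_add, ← pow_add, hC.kappa, Nat.card_eq_fintype_card, Fintype.card_fun, hF,
      Fintype.card_fin]
  rw [hperp, hcard C, hV, mul_right_comm] at hdual
  have hdual' := Nat.eq_of_mul_eq_mul_right (by positivity) hdual
  have : Nonempty (Fin n → Fin q) := ⟨fun _ => ⟨0, hq0⟩⟩
  obtain ⟨W, hW, hdet⟩ := hE.exists_encoder hχ (hperp C) (K := q ^ κ) (R := q ^ r)
    (by rw [hinf, hdual', hcard, pow_right_comm q 2 κ])
    (by rw [hinf, hcard, hcard, ← hC.gauge, pow_add, ← pow_mul q r, mul_comm r, pow_mul])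
  rw [hinf, hperp] at hdet
  obtain ⟨v, ⟨hvD, hvC⟩, hv0, hvδ⟩ := hC.dist.1
  refine ⟨⟨W, hW⟩, fun T E hT hET => ?_, Finset.univ.filter fun i => v i ≠ 0,
    weylMatrix e c β θ v, hvδ, actsOn_weylMatrix fun i hi => by simpa using hi,
    fun h => hvC ((hdet v).1 h hvD)⟩
  -- Detection is linear in the operator, so Weyl matrices supported in `T` suffice; an undetected
  -- one would have a label of weight below `δ` in the dual of the hull outside `C`.
  refine (Submodule.span_le.2 ?_ : _ ≤ (SubsystemCode.mk W hW).detected)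
    (hET.mem_span_weylMatrix (e := e) hc hθ hθβ)
  rintro _ ⟨u, hu, rfl⟩
  refine (hdet u).2 fun huD => ?_
  by_contra huC
  have h1 := hC.dist.2 ⟨u, ⟨huD, huC⟩, fun h0 => huC (h0 ▸ C.zero_mem), rfl⟩
  have h2 : hammingNorm u ≤ T.card := by
    refine Finset.card_le_card fun i hi => ?_
    by_contra hiT
    exact (Finset.mem_filter.1 hi).2 (hu i hiT)
  omega

theorem theorem6 {F : Type*} [Field F] [Fintype F] [DecidableEq F]
    (q : ℕ) (hq : IsPrimePow q) (hF : Fintype.card F = q ^ 2)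
    (n κ r δ : ℕ) (C : Submodule F (Fin n → F))
    (hC : IsSubsystemParams q C κ r δ) (hopt : IsOptimalParams n κ r δ)
    (s : ℕ) (hs1 : 1 ≤ s) (hs : s + 1 ≤ δ) :
    ((∃ C₁ : Submodule F (Fin (n - s) → F), IsSubsystemParams q C₁ κ (r + s) (δ - s)) ∧
      ExistsSubsystemCode q (n - s) κ (r + s) (δ - s) ∧
      IsOptimalParams (n - s) κ (r + s) (δ - s)) ∧
    (IsPureAt q C δ →
      (∃ C₂ : Submodule F (Fin (n - s) → F), IsSubsystemParams q C₂ (κ + s) r (δ - s)) ∧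
      ExistsSubsystemCode q (n - s) (κ + s) r (δ - s) ∧
      IsOptimalParams (n - s) (κ + s) r (δ - s)) := by
  obtain ⟨σ, hσ, hσσ⟩ := exists_ringHom_pow_involutive hq hF
  obtain ⟨⟨C₁, h1⟩, h2⟩ := hC.delete_iterate hσ hσσ s hs
  -- The new code satisfies a strict inequality below `n - s`, so this natural subtraction is not
  -- truncated and the integer equation can be transferred.
  have hsn : s ≤ n := by
    have h3 := h1.lt
    omega
  refine ⟨⟨⟨C₁, h1⟩, h1.existsSubsystemCode hq hF, ?_⟩, fun hp => ?_⟩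
  · unfold IsOptimalParams at *
    omega
  · obtain ⟨C₂, h3, -⟩ := h2 hp
    refine ⟨⟨C₂, h3⟩, h3.existsSubsystemCode hq hF, ?_⟩
    unfold IsOptimalParams at *
    omega
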